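/- Let $N^{\mathbb Q}$ be a torsion-free nilpotent group that is radicable, i.e. for every $n \in N^{\mathbb Q}$ and every integer $k>0$ there is $m \in N^{\mathbb Q}$ with $m^k = n$. Let $N^{\mathbb R}$ be its real Mal'cev completion, realised as follows. Let $c$ be the nilpotency class of $N^{\mathbb Q}$, let $I$ be the augmentation ideal of the real group algebra $\mathbb R[N^{\mathbb Q}]$, and put $A = \mathbb R[N^{\mathbb Q}]/I^{c+1}$. For $n \in N^{\mathbb Q}$ and $t \in \mathbb R$ let $n^t = \exp(t\log n) = \sum_{k=0}^{c} \binom{t}{k}(n-1)^k \in A^\times$. Then $N^{\mathbb R}$ is the subgroup of $A^\times$ generated by all $n^t$ with $n \in N^{\mathbb Q}$ and $t \in \mathbb R$, and $N^{\mathbb Q}$ is regarded as a subgroup of $N^{\mathbb R}$ via $n \mapsto n^1$. (If $N^{\mathbb Q}$ is the radicable hull of a finitely generated torsion-free nilpotent group $N$, then $N^{\mathbb R}$ is the connected and simply connected nilpotent Lie group that contains $N$ as a lattice.) Every group morphism $\varphi : N^{\mathbb Q} \to N^{\mathbb Q}$ induces an algebra endomorphism of $A$, and this restricts to an endomorphism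 $\varphi^{\mathbb R}$ of $N^{\mathbb R}$ that extends $\varphi$ and satisfies $\varphi^{\mathbb R}(n^t) = \varphi(n)^t$. For a radicable subgroup $H^{\mathbb Q} \le N^{\mathbb Q}$, let $H^{\mathbb R} \le N^{\mathbb R}$ be the subgroup generated by all $h^t$ with $h \in H^{\mathbb Q}$ and $t \in \mathbb R$. **Theorem.** Let $\varphi, \psi : N^{\mathbb Q} \to N^{\mathbb Q}$ be group morphisms and let $H^{\mathbb Q} = \{h \in N^{\mathbb Q} : \varphi(h) = \psi(h)\}$. Then $H^{\mathbb Q}$ is a radicable subgroup of $N^{\mathbb Q}$, and for all $n \in N^{\mathbb R}$ $$\varphi^{\mathbb R}(n)\,\psi^{\mathbb R}(n)^{-1} \in N^{\mathbb Q} \iff n \in N^{\mathbb Q} H^{\mathbb R},$$ where $N^{\mathbb Q} H^{\mathbb R} = \{mh : m \in N^{\mathbb Q},\ h \in H^{\mathbb R}\}$ is the product set, which need not be a subgroup. -/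

import Mathlib

/-! The real completion of a torsion-free radicable nilpotent group.

Let `N` be a nilpotent group of class `c` and let `I` be the augmentation ideal of the real group
algebra `ℝ[N]`. In `ℝ[N] ⧸ I ^ (c + 1)` every element `n` of `N` is unipotent, so that it has real
powers `n ^ t = exp (t log n)`. The real completion `N^ℝ` is the group of units generated by them,
that is, by the one-parameter subgroups through the elements of `N`; equivalently it is the
exponential of the real Lie algebra spanned by `log N`. If `N` is torsion-free, then it embeds in
this algebra (Jennings). If `N` is moreover radicable and of finite rank, then `log N` is the
rational Lie algebra that corresponds to `N`, the algebra is finite-dimensional, and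
`N^ℝ = exp (ℝ ⊗ log N)` is the connected and simply connected nilpotent Lie group in which `N` is
dense and which contains the finitely generated full subgroups of `N` as lattices. -/

namespace RealMalcev

noncomputable section

/-- The augmentation `ℝ[N] → ℝ`, which sends every element of `N` to `1`. -/
def augmentation (N : Type*) [Group N] : MonoidAlgebra ℝ N →ₐ[ℝ] ℝ :=
  MonoidAlgebra.lift ℝ ℝ N (1 : N →* ℝ)

/-- The augmentation ideal of `ℝ[N]`. -/
def augIdeal (N : Type*) [Group N] : Ideal (MonoidAlgebra ℝ N) :=
  RingHom.ker (augmentation N)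

instance (N : Type*) [Group N] : (augIdeal N).IsTwoSided :=
  inferInstanceAs (RingHom.ker (augmentation N)).IsTwoSided

/-- The algebra `ℝ[N] ⧸ I ^ (c + 1)`, where `c` is the nilpotency class of `N`. -/
abbrev TruncAlgebra (N : Type*) [Group N] [Group.IsNilpotent N] : Type _ :=
  MonoidAlgebra ℝ N ⧸ (augIdeal N ^ (Group.nilpotencyClass N + 1))

/-- The canonical map from `N` to the truncated group algebra. -/
def toTrunc (N : Type*) [Group N] [Group.IsNilpotent N] : N →* TruncAlgebra N :=
  (Ideal.Quotient.mk (augIdeal N ^ (Group.nilpotencyClass N + 1))).toMonoidHom.comp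
    (MonoidAlgebra.of ℝ N)

/-- The truncated binomial series `(1 + a) ^ t = ∑ k ≤ c, (t choose k) a ^ k`. -/
def binomialSum {A : Type*} [Ring A] [Algebra ℝ A] (c : ℕ) (a : A) (t : ℝ) : A :=
  ∑ k ∈ Finset.range (c + 1), Ring.choose t k • a ^ k

theorem binomialSum_zero {A : Type*} [Ring A] [Algebra ℝ A] (c : ℕ) (a : A) :
    binomialSum c a 0 = 1 := by
  unfold binomialSum
  rw [Finset.sum_range_succ', Finset.sum_eq_zero]
  · simp
  · intro k _
    rw [Ring.choose_zero_succ, zero_smul]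

theorem binomialSum_add {A : Type*} [Ring A] [Algebra ℝ A] (c : ℕ) (a : A)
    (ha : a ^ (c + 1) = 0) (s t : ℝ) :
    binomialSum c a (s + t) = binomialSum c a s * binomialSum c a t := by
  unfold binomialSum
  rw [Finset.sum_mul_sum]
  have h1 : ∀ k ∈ Finset.range (c + 1), Ring.choose (s + t) k • a ^ k =
      ∑ ij ∈ Finset.HasAntidiagonal.antidiagonal k,
        (Ring.choose s ij.1 * Ring.choose t ij.2) • a ^ (ij.1 + ij.2) := by
    intro k _
    rw [Ring.add_choose_eq k (Commute.all s t), Finset.sum_smul]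
    refine Finset.sum_congr rfl fun ij hij => ?_
    rw [Finset.HasAntidiagonal.mem_antidiagonal.mp hij]
  rw [Finset.sum_congr rfl h1, Finset.sum_sigma', ← Finset.sum_product']
  symm
  rw [← Finset.sum_filter_add_sum_filter_not _ (fun p : ℕ × ℕ => p.1 + p.2 ≤ c)]
  rw [Finset.sum_eq_zero (s := Finset.filter (fun p : ℕ × ℕ => ¬ p.1 + p.2 ≤ c) _), add_zero]
  · refine Finset.sum_bij' (fun p _ => ⟨p.1 + p.2, p⟩) (fun q _ => q.2) ?_ ?_ ?_ ?_ ?_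
    · intro p hp
      simp only [Finset.mem_filter, Finset.mem_product, Finset.mem_range] at hp
      simp only [Finset.mem_sigma, Finset.mem_range, Finset.HasAntidiagonal.mem_antidiagonal, and_true]
      omega
    · rintro ⟨k, p⟩ hq
      simp only [Finset.mem_sigma, Finset.mem_range, Finset.HasAntidiagonal.mem_antidiagonal] at hq
      simp only [Finset.mem_filter, Finset.mem_product, Finset.mem_range]
      omega
    · intro p _
      rfl
    · rintro ⟨k, p⟩ hq
      simp only [Finset.mem_sigma, Finset.mem_range, Finset.HasAntidiagonal.mem_antidiagonal] at hq
      obtain ⟨_, rfl⟩ := hq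
      rfl
    · intro p _
      rw [smul_mul_smul_comm, ← pow_add]
  · intro p hp
    simp only [Finset.mem_filter] at hp
    have h2 : a ^ (p.1 + p.2) = 0 := pow_eq_zero_of_le (by omega) ha
    rw [smul_mul_smul_comm, ← pow_add, h2, smul_zero]

theorem binomialSum_one {A : Type*} [Ring A] [Algebra ℝ A] (c : ℕ) (a : A)
    (ha : a ^ (c + 1) = 0) : binomialSum c a 1 = 1 + a := by
  have hch : ∀ k : ℕ, Ring.choose (1 : ℝ) k = (Nat.choose 1 k : ℝ) := by
    intro k
    have h := Ring.choose_natCast (R := ℝ) 1 k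
    simpa using h
  unfold binomialSum
  simp only [hch]
  cases c with
  | zero =>
    have h0 : a = 0 := by simpa using ha
    simp [h0]
  | succ c =>
    rw [Finset.sum_range_succ', Finset.sum_range_succ', Finset.sum_eq_zero]
    · simp [add_comm]
    · intro k _
      rw [Nat.choose_eq_zero_of_lt (by omega)]
      simp

theorem augIdeal_pow_le_comap {N : Type*} [Group N] (φ : N →* N) (k : ℕ) :
    augIdeal N ^ k ≤ (augIdeal N ^ k).comap (MonoidAlgebra.mapDomainAlgHom ℝ ℝ φ) := by
  have h : augIdeal N ≤ (augIdeal N).comap (MonoidAlgebra.mapDomainAlgHom ℝ ℝ φ) := by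
    intro x hx
    have hc : (augmentation N).comp (MonoidAlgebra.mapDomainAlgHom ℝ ℝ φ) = augmentation N := by
      apply MonoidAlgebra.algHom_ext
      · intro n
        simp [augmentation, MonoidAlgebra.lift_single]
      · exact Subsingleton.elim _ _
    have hx' : augmentation N x = 0 := hx
    show augmentation N (MonoidAlgebra.mapDomainAlgHom ℝ ℝ φ x) = 0
    rw [← hx']
    exact DFunLike.congr_fun hc x
  induction k with
  | zero =>
    rw [Submodule.pow_zero, Ideal.one_eq_top, Ideal.comap_top]
  | succ k ih =>
    rw [Submodule.pow_succ, Ideal.mul_le]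
    intro r hr s hs
    rw [Ideal.mem_comap, map_mul]
    exact Ideal.mul_mem_mul (ih hr) (h hs)

section

variable {N : Type*} [Group N] [Group.IsNilpotent N]

theorem toTrunc_sub_one_pow (n : N) :
    (toTrunc N n - 1) ^ (Group.nilpotencyClass N + 1) = 0 := by
  have h1 : MonoidAlgebra.of ℝ N n - 1 ∈ augIdeal N := by
    simp [augIdeal, augmentation, RingHom.mem_ker, MonoidAlgebra.lift_single]
  have h2 := Ideal.pow_mem_pow h1 (Group.nilpotencyClass N + 1)
  have h3 := Ideal.Quotient.eq_zero_iff_mem.mpr h2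
  rw [map_pow, map_sub, map_one] at h3
  exact h3

/-- The real power `n ^ t = exp (t log n)`, as a unit of the truncated group algebra; it is the
(finite) binomial series of `(1 + (n - 1)) ^ t`. -/
def realPow (n : N) (t : ℝ) : (TruncAlgebra N)ˣ where
  val := binomialSum (Group.nilpotencyClass N) (toTrunc N n - 1) t
  inv := binomialSum (Group.nilpotencyClass N) (toTrunc N n - 1) (-t)
  val_inv := by
    rw [← binomialSum_add _ _ (toTrunc_sub_one_pow n), add_neg_cancel, binomialSum_zero]
  inv_val := by
    rw [← binomialSum_add _ _ (toTrunc_sub_one_pow n), neg_add_cancel, binomialSum_zero]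

theorem realPow_one (n : N) : ((realPow n 1 : (TruncAlgebra N)ˣ) : TruncAlgebra N) = toTrunc N n := by
  show binomialSum _ _ _ = _
  rw [binomialSum_one _ _ (toTrunc_sub_one_pow n)]
  abel

theorem realPow_add (n : N) (s t : ℝ) : realPow n (s + t) = realPow n s * realPow n t :=
  Units.ext (binomialSum_add _ _ (toTrunc_sub_one_pow n) s t)

variable (N) in
/-- The real completion `N^ℝ`: the group generated by all real powers of elements of `N`. -/
def RealCompletion : Subgroup (TruncAlgebra N)ˣ :=
  Subgroup.closure {u | ∃ (n : N) (t : ℝ), u = realPow n t}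

theorem realPow_mem (n : N) (t : ℝ) : realPow n t ∈ RealCompletion N :=
  Subgroup.subset_closure ⟨n, t, rfl⟩

variable (N) in
/-- The canonical map `N → N^ℝ`, under which `n` is its own real power `n ^ 1`. -/
def toReal : N →* RealCompletion N where
  toFun n := ⟨realPow n 1, realPow_mem n 1⟩
  map_one' := by
    refine Subtype.ext (Units.ext ?_)
    show ((realPow (1 : N) 1 : (TruncAlgebra N)ˣ) : TruncAlgebra N) = 1
    rw [realPow_one, map_one]
  map_mul' m n := by
    refine Subtype.ext (Units.ext ?_)
    show ((realPow (m * n) 1 : (TruncAlgebra N)ˣ) : TruncAlgebra N) =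
      (realPow m 1 : (TruncAlgebra N)ˣ) * (realPow n 1 : (TruncAlgebra N)ˣ)
    rw [realPow_one, realPow_one, realPow_one, map_mul]

variable (N) in
/-- The group `N = N^ℚ`, as a subgroup of `N^ℝ`. -/
def rationalPoints : Subgroup (RealCompletion N) :=
  (toReal N).range

/-- For a subgroup `H = H^ℚ` of `N`, the subgroup `H^ℝ` of `N^ℝ`: it is generated by all real
powers of elements of `H`. -/
def realSpan (H : Subgroup N) : Subgroup (RealCompletion N) :=
  Subgroup.closure {u | ∃ h ∈ H, ∃ t : ℝ, u = ⟨realPow h t, realPow_mem h t⟩}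

/-- The endomorphism of the truncated group algebra induced by an endomorphism of `N`. -/
def truncMap (φ : N →* N) : TruncAlgebra N →ₐ[ℝ] TruncAlgebra N :=
  Ideal.quotientMapₐ _ (MonoidAlgebra.mapDomainAlgHom ℝ ℝ φ) (augIdeal_pow_le_comap φ _)

theorem truncMap_toTrunc (φ : N →* N) (n : N) :
    truncMap φ (toTrunc N n) = toTrunc N (φ n) := by
  show Ideal.Quotient.mk _ (MonoidAlgebra.mapDomainAlgHom ℝ ℝ φ (MonoidAlgebra.of ℝ N n)) =
    Ideal.Quotient.mk _ (MonoidAlgebra.of ℝ N (φ n))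
  simp

theorem map_realPow (φ : N →* N) (n : N) (t : ℝ) :
    Units.map (truncMap φ : TruncAlgebra N →* TruncAlgebra N) (realPow n t) =
      realPow (φ n) t := by
  refine Units.ext ?_
  show truncMap φ (binomialSum _ _ t) = binomialSum _ _ t
  simp only [binomialSum, map_sum, map_smul, map_pow, map_sub, map_one, truncMap_toTrunc]

/-- The extension `φ^ℝ : N^ℝ → N^ℝ` of `φ : N → N`, with `φ^ℝ (n ^ t) = (φ n) ^ t`. -/
def realExtension (φ : N →* N) : RealCompletion N →* RealCompletion N :=
  ((Units.map (truncMap φ : TruncAlgebra N →* TruncAlgebra N)).comp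
    (RealCompletion N).subtype).codRestrict (RealCompletion N) (by
      have h : RealCompletion N ≤ (RealCompletion N).comap
          (Units.map (truncMap φ : TruncAlgebra N →* TruncAlgebra N)) := by
        refine (Subgroup.closure_le _).mpr ?_
        rintro _ ⟨n, t, rfl⟩
        rw [SetLike.mem_coe, Subgroup.mem_comap, map_realPow]
        exact realPow_mem _ _
      exact fun u => h u.2)

theorem realExtension_realPow (φ : N →* N) (n : N) (t : ℝ) :
    realExtension φ ⟨realPow n t, realPow_mem n t⟩ =
      ⟨realPow (φ n) t, realPow_mem (φ n) t⟩ :=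
  Subtype.ext (map_realPow φ n t)

theorem realExtension_toReal (φ : N →* N) (n : N) :
    realExtension φ (toReal N n) = toReal N (φ n) :=
  realExtension_realPow φ n 1

end

end

end RealMalcev

open scoped Pointwise

/-! Let `δ = φ - ψ` be the difference of the two induced endomorphisms of `A = ℝ[N] ⧸ I ^ (c + 1)`.
The elements `n` of `N` with `δ n ∈ I ^ i` form a descending chain of isolated subgroups `K i` from
`N` to the coincidence subgroup `H`; that it ends there is the injectivity of `N → A` (Jennings),
proved by building up a separated subgroup through one-parameter subgroups `ℚ → N`. Modulo
`I ^ (i + 1)` the map `δ` is additive and homogeneous under real powers on `K i ^ℝ`.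

If `φ^ℝ x * (ψ^ℝ x)⁻¹ = n ∈ N` with `x ∈ K i ^ℝ`, then `δ x ≡ n - 1` modulo `I ^ (i + 1)`, which has
rational coefficients. Applying a `ℚ`-linear retraction `ℝ → ℚ` to the coefficients, which preserves
the powers of `I`, turns `δ x` into `δ k` for some `k ∈ K i`; hence `δ k ≡ δ x` and
`k⁻¹ * x ∈ K i ^ℝ` vanishes under `δ` modulo `I ^ (i + 1)`. It lies in `K (i + 1) ^ℝ`: write it
modulo `K (i + 1) ^ℝ` as a product of powers `k l ^ s l` with rationally independent exponents, so
that coordinate functionals of the `s l` force each `δ (k l)` into `I ^ (i + 1)`. Starting from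
`K 0 = N`, this descent reaches `H`.

Membership of commutators and the like in `K ^ℝ` is checked on integral exponents and extended to
real ones by polynomiality. -/

open scoped commutatorElement

namespace RealMalcev

section Isolated

variable {N : Type*} [Group N]

variable (N) in
/-- A group is radicable if it has roots of all positive orders. -/
def IsRadicable : Prop := ∀ (n : N) (k : ℕ), 0 < k → ∃ m : N, m ^ k = n

/-- A subgroup is isolated if it contains every element that has a positive power in it. The group
`N` is torsion-free if and only if its trivial subgroup is isolated. -/
def IsIsolated (G : Subgroup N) : Prop := ∀ ⦃x : N⦄ ⦃k : ℕ⦄, 0 < k → x ^ k ∈ G → x ∈ G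

theorem isIsolated_bot (htf : ∀ n : N, n ≠ 1 → ¬ IsOfFinOrder n) :
    IsIsolated (⊥ : Subgroup N) := fun x k hk hx => by
  by_contra hne
  exact htf x hne (isOfFinOrder_iff_pow_eq_one.mpr ⟨k, hk, hx⟩)

end Isolated

section LowerCentral

variable {N : Type*} [Group N]

theorem commutator_commutator_le_of_rotate {H₁ H₂ H₃ K : Subgroup N} [K.Normal]
    (h₁ : ⁅⁅H₂, H₃⁆, H₁⁆ ≤ K) (h₂ : ⁅⁅H₃, H₁⁆, H₂⁆ ≤ K) : ⁅⁅H₁, H₂⁆, H₃⁆ ≤ K := by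
  have hmod : ∀ A B C : Subgroup N, ⁅⁅A, B⁆, C⁆ ≤ K ↔
      ⁅⁅A.map (QuotientGroup.mk' K), B.map (QuotientGroup.mk' K)⁆,
        C.map (QuotientGroup.mk' K)⁆ = ⊥ := fun A B C => by
    rw [← Subgroup.map_commutator, ← Subgroup.map_commutator, Subgroup.map_eq_bot_iff,
      QuotientGroup.ker_mk']
  rw [hmod] at *
  exact Subgroup.commutator_commutator_eq_bot_of_rotate h₁ h₂

variable (N) in
/-- The lower central series of `N`, numbered so that `lcs N 0` is the whole group. -/
def lcs (n : ℕ) : Subgroup N := (⊤ : Subgroup N).lowerCentralSeries n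

instance lcs_normal (n : ℕ) : (lcs N n).Normal :=
  inferInstanceAs ((⊤ : Subgroup N).lowerCentralSeries n).Normal

theorem mem_lcs_zero (n : N) : n ∈ lcs N 0 := Subgroup.mem_top n

theorem lcs_antitone : Antitone (lcs N) := Subgroup.lowerCentralSeries_antitone _

theorem lcs_nilpotencyClass [Group.IsNilpotent N] : lcs N (Group.nilpotencyClass N) = ⊥ :=
  Subgroup.lowerCentralSeries_nilpotencyClass

theorem commutatorElement_mem_lcs_succ {j : ℕ} {x : N} (hx : x ∈ lcs N j) (y : N) :
    ⁅x, y⁆ ∈ lcs N (j + 1) :=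
  Subgroup.commutator_mem_commutator hx (Subgroup.mem_top y)

theorem commutator_lcs_le (a b : ℕ) : ⁅lcs N a, lcs N b⁆ ≤ lcs N (a + b + 1) := by
  induction b generalizing a with
  | zero => exact le_rfl
  | succ b ih =>
    rw [Subgroup.commutator_comm]
    refine commutator_commutator_le_of_rotate ?_ (Subgroup.commutator_mono (ih a) le_rfl)
    rw [Subgroup.commutator_comm ⊤, show a + (b + 1) + 1 = a + 1 + b + 1 by ring]
    exact ih (a + 1)

theorem mk_commute_of_mem_lcs {K : Subgroup N} [K.Normal] {j : ℕ} (hK : lcs N (j + 1) ≤ K)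
    {z : N} (hz : z ∈ lcs N j) (g : N ⧸ K) : Commute (z : N ⧸ K) g := by
  obtain ⟨x, rfl⟩ := QuotientGroup.mk_surjective g
  rw [← commutatorElement_eq_one_iff_commute]
  exact (QuotientGroup.eq_one_iff _).mpr (hK (commutatorElement_mem_lcs_succ hz x))

theorem normal_of_lcs_le {m : ℕ} {G : Subgroup N} (hG : lcs N (m + 1) ≤ G) (hGm : G ≤ lcs N m) :
    G.Normal where
  conj_mem g hg n := by
    have hcomm : ⁅g, n⁆⁻¹ ∈ G := inv_mem (hG (commutatorElement_mem_lcs_succ (hGm hg) n))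
    rw [commutatorElement_inv] at hcomm
    simpa [commutatorElement_def] using mul_mem hcomm hg

/-- Commutation with a fixed element `y`, as a map from a term of the lower central series to the
next factor of the series; modulo `lcs N (j + 2)` it is multiplicative. -/
def commutatorHom (j : ℕ) (y : N) : lcs N j →* N ⧸ lcs N (j + 1 + 1) :=
  MonoidHom.mk' (fun x => (⁅(x : N), y⁆ : N)) fun a b => by
    have hcomm := mk_commute_of_mem_lcs le_rfl (commutatorElement_mem_lcs_succ b.2 y)
    rw [Subgroup.coe_mul, commutatorElement_mul_left_eq_conj_mul,
      QuotientGroup.mk_mul, QuotientGroup.mk_mul, QuotientGroup.mk_mul, QuotientGroup.mk_inv,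
      ← (hcomm (a : N)).eq, mul_inv_cancel_right, (hcomm _).eq]

theorem exists_pow_mod_lcs (hrad : IsRadicable N) {k : ℕ} (hk : 0 < k) (j : ℕ) {a : N}
    (ha : a ∈ lcs N j) :
    ∃ b ∈ lcs N j, (a : N ⧸ lcs N (j + 1)) = (b : N ⧸ lcs N (j + 1)) ^ k := by
  induction j generalizing a with
  | zero =>
    obtain ⟨m, rfl⟩ := hrad a k hk
    exact ⟨m, mem_lcs_zero m, rfl⟩
  | succ j ih =>
    rw [show lcs N (j + 1) = ⁅lcs N j, ⊤⁆ from rfl, Subgroup.commutator_def] at ha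
    induction ha using Subgroup.closure_induction with
    | one => exact ⟨1, one_mem _, by simp⟩
    | mul x y _ _ hbx hby =>
      obtain ⟨b, hb, hxb⟩ := hbx
      obtain ⟨c, hc, hyc⟩ := hby
      refine ⟨b * c, mul_mem hb hc, ?_⟩
      rw [QuotientGroup.mk_mul, QuotientGroup.mk_mul,
        (mk_commute_of_mem_lcs le_rfl hb c).mul_pow, hxb, hyc]
    | inv x _ hbx =>
      obtain ⟨b, hb, hxb⟩ := hbx
      exact ⟨b⁻¹, inv_mem hb, by rw [QuotientGroup.mk_inv, QuotientGroup.mk_inv, hxb, inv_pow]⟩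
    | mem x hx =>
      obtain ⟨a, ha, y, -, rfl⟩ := hx
      obtain ⟨b, hb, hab⟩ := ih ha
      have hz : (b ^ k)⁻¹ * a ∈ lcs N (j + 1) := by rwa [← QuotientGroup.eq, eq_comm]
      refine ⟨⁅b, y⁆, commutatorElement_mem_lcs_succ hb y, ?_⟩
      have hkill : commutatorHom j y ((⟨b, hb⟩ ^ k)⁻¹ * ⟨a, ha⟩) = 1 :=
        (QuotientGroup.eq_one_iff _).mpr (commutatorElement_mem_lcs_succ hz y)
      rw [map_mul, map_inv, map_pow, inv_mul_eq_one] at hkill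
      exact hkill.symm

theorem exists_mul_pow_mem_lcs (hrad : IsRadicable N) {j k : ℕ} (hk : 0 < k) {x : N}
    (hx : x ^ k ∈ lcs N j) (l : ℕ) : ∃ u ∈ lcs N j, (x * u) ^ k ∈ lcs N (j + l) := by
  induction l with
  | zero => exact ⟨1, one_mem _, by simpa using hx⟩
  | succ l ih =>
    obtain ⟨u, hu, hxu⟩ := ih
    obtain ⟨v, hv, hvk⟩ := exists_pow_mod_lcs hrad hk _ hxu
    refine ⟨u * v⁻¹, mul_mem hu (inv_mem (lcs_antitone (Nat.le_add_right _ _) hv)), ?_⟩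
    rw [← add_assoc, ← QuotientGroup.eq_one_iff, ← mul_assoc, QuotientGroup.mk_pow,
      QuotientGroup.mk_mul, (mk_commute_of_mem_lcs le_rfl (inv_mem hv) _).symm.mul_pow,
      ← QuotientGroup.mk_pow, hvk, QuotientGroup.mk_inv, inv_pow, mul_inv_cancel]

theorem isIsolated_lcs [Group.IsNilpotent N] (htf : IsIsolated (⊥ : Subgroup N))
    (hrad : IsRadicable N) (j : ℕ) : IsIsolated (lcs N j) := fun x k hk hx => by
  obtain ⟨u, hu, hxu⟩ := exists_mul_pow_mem_lcs hrad hk hx (Group.nilpotencyClass N)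
  have hbot := lcs_antitone (Nat.le_add_left (Group.nilpotencyClass N) j) hxu
  rw [lcs_nilpotencyClass] at hbot
  exact (mul_mem_cancel_right hu).mp ((htf hk hbot : x * u = 1) ▸ one_mem _)

end LowerCentral

section Augmentation

open MonoidAlgebra (of)

variable {N : Type*} [Group N]

theorem of_sub_one_mem_augIdeal (n : N) : of ℝ N n - 1 ∈ augIdeal N := by
  simp [augIdeal, augmentation, RingHom.mem_ker, MonoidAlgebra.lift_single]

theorem sub_algebraMap_augmentation_mem (x : MonoidAlgebra ℝ N) :
    x - algebraMap ℝ _ (augmentation N x) ∈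
      Submodule.span ℝ (Set.range fun n : N => of ℝ N n - 1) := by
  induction x using MonoidAlgebra.induction_linear with
  | zero => simp
  | add x y hx hy =>
    rw [map_add, map_add, add_sub_add_comm]
    exact add_mem hx hy
  | single n r =>
    have hsingle : MonoidAlgebra.single n r - algebraMap ℝ _ (augmentation N (.single n r)) =
        r • (of ℝ N n - 1) := by
      simp [augmentation, MonoidAlgebra.lift_single, smul_sub, Algebra.algebraMap_eq_smul_one]
    rw [hsingle]
    exact Submodule.smul_mem _ _ (Submodule.subset_span ⟨n, rfl⟩)

theorem mem_span_of_mem_augIdeal {x : MonoidAlgebra ℝ N} (hx : x ∈ augIdeal N) :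
    x ∈ Submodule.span ℝ (Set.range fun n : N => of ℝ N n - 1) := by
  have hmem := sub_algebraMap_augmentation_mem x
  rwa [show augmentation N x = 0 from hx, map_zero, sub_zero] at hmem

/-- The linear map on the group algebra with prescribed values on the group elements. -/
noncomputable def linLift {V : Type*} [AddCommGroup V] [Module ℝ V] (f : N → V) :
    MonoidAlgebra ℝ N →ₗ[ℝ] V :=
  Finsupp.linearCombination ℝ f ∘ₗ (MonoidAlgebra.coeffLinearEquiv ℝ).toLinearMap

@[simp]
theorem linLift_of {V : Type*} [AddCommGroup V] [Module ℝ V] (f : N → V) (n : N) :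
    linLift f (of ℝ N n) = f n := by
  simp [linLift, MonoidAlgebra.coeffLinearEquiv]

theorem linLift_one {V : Type*} [AddCommGroup V] [Module ℝ V] (f : N → V) :
    linLift f 1 = f 1 := by
  rw [← map_one (of ℝ N), linLift_of]

/-- Conjugation by `p` on the group algebra. -/
noncomputable def conjAlg (p : N) : MonoidAlgebra ℝ N →ₐ[ℝ] MonoidAlgebra ℝ N :=
  MonoidAlgebra.mapDomainAlgHom ℝ ℝ (MulAut.conj p).toMonoidHom

@[simp]
theorem conjAlg_of (p w : N) : conjAlg p (of ℝ N w) = of ℝ N (p * w * p⁻¹) := by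
  simp [conjAlg]

theorem conjAlg_apply (p : N) (y : MonoidAlgebra ℝ N) :
    conjAlg p y = of ℝ N p * y * of ℝ N p⁻¹ := by
  induction y using MonoidAlgebra.induction_linear with
  | zero => simp
  | add x y hx hy => rw [map_add, hx, hy, mul_add, add_mul]
  | single n r => simp [conjAlg]

end Augmentation

section Weight

open MonoidAlgebra (of)

variable {N : Type*} [Group N] {G G' : Subgroup N}

/-- The products `(w₁ - 1) ⋯ (wᵣ - 1)` of total weight `k`, where `wⱼ` lies in `G` and has weight
`i + 1` if it is taken from `lcs N i`. -/
inductive WeightMonomial (G : Subgroup N) : ℕ → MonoidAlgebra ℝ N → Prop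
  | one : WeightMonomial G 0 1
  | step {i k : ℕ} {w : N} {y : MonoidAlgebra ℝ N} (hG : w ∈ G) (hw : w ∈ lcs N i)
      (hy : WeightMonomial G k y) :
      WeightMonomial G (k + i + 1) ((of ℝ N w - 1) * y)

/-- The span of the products of weight at least `k` of elements `w - 1` with `w` in `G`. -/
noncomputable def weightSpan (G : Subgroup N) (k : ℕ) : Submodule ℝ (MonoidAlgebra ℝ N) :=
  Submodule.span ℝ {y | ∃ l, k ≤ l ∧ WeightMonomial G l y}

theorem WeightMonomial.mem_weightSpan {k : ℕ} {y : MonoidAlgebra ℝ N}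
    (h : WeightMonomial G k y) : y ∈ weightSpan G k :=
  Submodule.subset_span ⟨k, le_rfl, h⟩

theorem weightSpan_antitone (G : Subgroup N) : Antitone (weightSpan G) := fun _ _ h =>
  Submodule.span_mono fun _ ⟨l, hl, hy⟩ => ⟨l, h.trans hl, hy⟩

theorem WeightMonomial.mono (h : G ≤ G') {k : ℕ} {y : MonoidAlgebra ℝ N}
    (hy : WeightMonomial G k y) : WeightMonomial G' k y := by
  induction hy with
  | one => exact .one
  | step hG hw _ ih => exact .step (h hG) hw ih

theorem weightSpan_mono (h : G ≤ G') (k : ℕ) : weightSpan G k ≤ weightSpan G' k :=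
  Submodule.span_mono fun _ ⟨l, hl, hy⟩ => ⟨l, hl, hy.mono h⟩

theorem sub_one_mul_mem_weightSpan {w : N} {i k : ℕ} (hG : w ∈ G) (hw : w ∈ lcs N i)
    {y : MonoidAlgebra ℝ N} (hy : y ∈ weightSpan G k) :
    (of ℝ N w - 1) * y ∈ weightSpan G (k + i + 1) := by
  have hle : weightSpan G k ≤ (weightSpan G (k + i + 1)).comap
      (LinearMap.mulLeft ℝ (of ℝ N w - 1)) := by
    refine Submodule.span_le.mpr ?_
    rintro y ⟨l, hl, hy⟩
    exact Submodule.subset_span ⟨_, by omega, .step hG hw hy⟩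
  exact hle hy

theorem of_mul_mem_weightSpan {w : N} {k : ℕ} (hG : w ∈ G) {y : MonoidAlgebra ℝ N}
    (hy : y ∈ weightSpan G k) : of ℝ N w * y ∈ weightSpan G k := by
  have hsub := weightSpan_antitone G (show k ≤ k + 0 + 1 by omega)
    (sub_one_mul_mem_weightSpan hG (mem_lcs_zero w) hy)
  rw [sub_mul, one_mul] at hsub
  simpa only [sub_add_cancel] using add_mem hsub hy

theorem mul_mem_weightSpan_top {x y : MonoidAlgebra ℝ N} (hx : x ∈ augIdeal N) {k : ℕ}
    (hy : y ∈ weightSpan (⊤ : Subgroup N) k) : x * y ∈ weightSpan (⊤ : Subgroup N) (k + 1) := by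
  refine (Submodule.span_le.mpr ?_ : _ ≤ (weightSpan ⊤ (k + 1)).comap
    (LinearMap.mulRight ℝ y)) (mem_span_of_mem_augIdeal hx)
  rintro _ ⟨n, rfl⟩
  exact sub_one_mul_mem_weightSpan (Subgroup.mem_top n) (mem_lcs_zero n) hy

theorem weightSpan_top_zero : weightSpan (⊤ : Subgroup N) 0 = ⊤ := by
  refine eq_top_iff.mpr fun x _ => ?_
  have hone : (1 : MonoidAlgebra ℝ N) ∈ weightSpan (⊤ : Subgroup N) 0 :=
    WeightMonomial.one.mem_weightSpan
  have haug : x - algebraMap ℝ _ (augmentation N x) ∈ augIdeal N := by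
    change augmentation N _ = 0
    rw [map_sub, AlgHom.commutes]
    exact sub_self _
  have hmem := weightSpan_antitone _ (Nat.zero_le 1) (mul_mem_weightSpan_top haug hone)
  rw [mul_one, Algebra.algebraMap_eq_smul_one] at hmem
  simpa only [sub_add_cancel] using add_mem hmem (Submodule.smul_mem _ (augmentation N x) hone)

theorem mem_weightSpan_top_of_mem_augIdeal_pow {k : ℕ} {x : MonoidAlgebra ℝ N}
    (hx : x ∈ augIdeal N ^ k) : x ∈ weightSpan (⊤ : Subgroup N) k := by
  induction k generalizing x with
  | zero => rw [weightSpan_top_zero]; exact Submodule.mem_top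
  | succ k ih =>
    rw [Ideal.IsTwoSided.pow_succ] at hx
    induction hx using Submodule.mul_induction_on' with
    | mem_mul_mem r hr s hs => exact mul_mem_weightSpan_top hr (ih hs)
    | add x _ y _ hx hy => exact add_mem hx hy

theorem WeightMonomial.conjAlg_sub_mem [G.Normal] {m : ℕ} {p : N} (hp : p ∈ lcs N m) {k : ℕ}
    {y : MonoidAlgebra ℝ N} (hy : WeightMonomial G k y) :
    conjAlg p y - y ∈ weightSpan G (k + m + 1) := by
  induction hy with
  | one => rw [map_one, sub_self]; exact zero_mem _
  | @step i k w y hG hw hy ih =>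
    have hconj : of ℝ N (p * w * p⁻¹) = of ℝ N ⁅p, w⁆ * of ℝ N w := by
      rw [← map_mul, commutatorElement_def, inv_mul_cancel_right]
    have hsplit : conjAlg p ((of ℝ N w - 1) * y) - (of ℝ N w - 1) * y =
        (of ℝ N (p * w * p⁻¹) - 1) * (conjAlg p y - y) +
          (of ℝ N ⁅p, w⁆ - 1) * (of ℝ N w * y) := by
      rw [map_mul, map_sub, map_one, conjAlg_of, hconj]
      noncomm_ring
    have hwG : p * w * p⁻¹ ∈ G := ‹G.Normal›.conj_mem w hG p
    have hwi : p * w * p⁻¹ ∈ lcs N i := (lcs_normal i).conj_mem w hw p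
    have hcG : ⁅p, w⁆ ∈ G := by
      rw [commutatorElement_def]
      exact mul_mem hwG (inv_mem hG)
    have hci : ⁅p, w⁆ ∈ lcs N (m + i + 1) :=
      commutator_lcs_le m i (Subgroup.commutator_mem_commutator hp hw)
    rw [hsplit]
    exact add_mem
      (weightSpan_antitone G (by omega) (sub_one_mul_mem_weightSpan hwG hwi ih))
      (weightSpan_antitone G (by omega) (sub_one_mul_mem_weightSpan hcG hci
        (of_mul_mem_weightSpan hG hy.mem_weightSpan)))

theorem conjAlg_sub_mem_weightSpan [G.Normal] {m : ℕ} {p : N} (hp : p ∈ lcs N m) {k : ℕ}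
    {y : MonoidAlgebra ℝ N} (hy : y ∈ weightSpan G k) :
    conjAlg p y - y ∈ weightSpan G (k + m + 1) := by
  have hle : weightSpan G k ≤ (weightSpan G (k + m + 1)).comap
      ((conjAlg p).toLinearMap - LinearMap.id) := by
    refine Submodule.span_le.mpr ?_
    rintro y ⟨l, hl, hy⟩
    exact weightSpan_antitone G (by omega) (hy.conjAlg_sub_mem hp)
  exact hle hy

end Weight

section Separated

open MonoidAlgebra (of)

variable {N : Type*} [Group N] {G₁ G : Subgroup N} {c m : ℕ}

/-- Elements `h` of `G` other than `1` are detected by the weight filtration of `G`: the difference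
`h - 1` does not have weight `c + 1`. -/
def Separated (c : ℕ) (G : Subgroup N) : Prop :=
  ∀ h ∈ G, of ℝ N h - 1 ∈ weightSpan G (c + 1) → h = 1

/-- `G` is an extension of `G₁` by the rational one-parameter subgroup `τ` inside the `m`-th
factor of the lower central series, and `χ` is the coordinate `G → G ⧸ G₁ → ℚ`. -/
structure IsRationalExtension (m : ℕ) (G₁ G : Subgroup N) (τ : Multiplicative ℚ →* N)
    (χ : N → Multiplicative ℚ) : Prop where
  lcs_le : lcs N (m + 1) ≤ G₁
  le : G₁ ≤ G
  le_lcs : G ≤ lcs N m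
  mem_lcs : ∀ q, τ q ∈ lcs N m
  map_mul : ∀ g ∈ G, ∀ h ∈ G, χ (g * h) = χ g * χ h
  eq_one_iff : ∀ g ∈ G, χ g = 1 ↔ g ∈ G₁
  mul_inv_mem : ∀ g ∈ G, g * (τ (χ g))⁻¹ ∈ G₁

theorem WeightMonomial.mem_span_of {k : ℕ} {y : MonoidAlgebra ℝ N} (hy : WeightMonomial G k y) :
    y ∈ Submodule.span ℝ (of ℝ N '' G) := by
  induction hy with
  | one => exact Submodule.subset_span ⟨1, one_mem _, map_one _⟩
  | @step i k w y hG _ _ ih =>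
    rw [sub_mul, one_mul]
    refine sub_mem ((Submodule.span_le.mpr ?_ :
      _ ≤ (Submodule.span ℝ _).comap (LinearMap.mulLeft ℝ (of ℝ N w))) ih) ih
    rintro _ ⟨g, hg, rfl⟩
    exact Submodule.subset_span ⟨w * g, mul_mem hG hg, map_mul _ _ _⟩

theorem WeightMonomial.augmentation_eq_zero {k : ℕ} {y : MonoidAlgebra ℝ N}
    (hy : WeightMonomial G k y) (hk : k ≠ 0) : augmentation N y = 0 := by
  cases hy with
  | one => exact absurd rfl hk
  | step hG hw hy =>
    rw [_root_.map_mul, show augmentation N _ = 0 from of_sub_one_mem_augIdeal _, zero_mul]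

theorem linLift_sub_one_mul {χ : N → ℝ} (hχ : ∀ g ∈ G, ∀ h ∈ G, χ (g * h) = χ g + χ h) {w : N}
    (hw : w ∈ G) {y : MonoidAlgebra ℝ N} (hy : y ∈ Submodule.span ℝ (of ℝ N '' G)) :
    linLift χ ((of ℝ N w - 1) * y) = χ w * augmentation N y := by
  induction hy using Submodule.span_induction with
  | mem y hy =>
    obtain ⟨g, hg, rfl⟩ := hy
    rw [sub_mul, one_mul, map_sub, ← _root_.map_mul, linLift_of, linLift_of, hχ w hw g hg]
    simp [augmentation, MonoidAlgebra.lift_single]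
  | zero => simp
  | add x y _ _ hx hy => rw [mul_add, map_add, map_add, hx, hy, mul_add]
  | smul a x _ hx =>
    rw [mul_smul_comm, map_smul, map_smul, hx, smul_eq_mul, smul_eq_mul, mul_left_comm]

theorem weightSpan_le_ker_linLift {χ : N → ℝ} (hχ : ∀ g ∈ G, ∀ h ∈ G, χ (g * h) = χ g + χ h)
    (hχ0 : ∀ g ∈ G, g ∈ lcs N (m + 1) → χ g = 0) (hmc : m < c) :
    weightSpan G (c + 1) ≤ LinearMap.ker (linLift χ) := by
  refine Submodule.span_le.mpr ?_
  rintro y ⟨l, hl, hy⟩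
  cases hy with
  | one => omega
  | @step i k w y hG hw hy =>
    rw [SetLike.mem_coe, LinearMap.mem_ker, linLift_sub_one_mul hχ hG hy.mem_span_of]
    by_cases hk : k = 0
    · rw [hχ0 w hG (lcs_antitone (by omega) hw), zero_mul]
    · rw [hy.augmentation_eq_zero hk, mul_zero]

namespace IsRationalExtension

variable {τ : Multiplicative ℚ →* N} {χ : N → Multiplicative ℚ}

theorem map_eq_one (h : IsRationalExtension m G₁ G τ χ) {g : N} (hg : g ∈ G₁) : χ g = 1 :=
  (h.eq_one_iff g (h.le hg)).mpr hg

theorem mem_of_sub_one_mem (h : IsRationalExtension m G₁ G τ χ) (hmc : m < c) {g : N}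
    (hg : g ∈ G) (hmem : of ℝ N g - 1 ∈ weightSpan G (c + 1)) : g ∈ G₁ := by
  let χ' : N → ℝ := fun g => ((χ g).toAdd : ℚ)
  have hχ' : ∀ g ∈ G, ∀ g' ∈ G, χ' (g * g') = χ' g + χ' g' := fun g hg g' hg' => by
    simp only [χ', h.map_mul g hg g' hg', toAdd_mul, Rat.cast_add]
  have hχ'0 : ∀ g ∈ G₁, χ' g = 0 := fun g hg => by
    simp only [χ', h.map_eq_one hg, toAdd_one, Rat.cast_zero]
  have hker := weightSpan_le_ker_linLift hχ' (fun g _ hg => hχ'0 g (h.lcs_le hg)) hmc hmem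
  rw [LinearMap.mem_ker, map_sub, linLift_of, linLift_one, hχ'0 1 (one_mem _), sub_zero] at hker
  exact (h.eq_one_iff g hg).mp (Rat.cast_eq_zero.mp hker)

/-- The linear retraction of the group algebra of `G` to that of `G₁`, which sends `g` to the
component `g * (τ (χ g))⁻¹` of `g` in `G₁`. -/
noncomputable def retraction (τ : Multiplicative ℚ →* N) (χ : N → Multiplicative ℚ) :
    MonoidAlgebra ℝ N →ₗ[ℝ] MonoidAlgebra ℝ N :=
  linLift fun g => of ℝ N (g * (τ (χ g))⁻¹)

theorem retraction_of (h : IsRationalExtension m G₁ G τ χ) {g : N} (hg : g ∈ G₁) :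
    retraction τ χ (of ℝ N g) = of ℝ N g := by
  rw [retraction, linLift_of, h.map_eq_one hg, map_one, inv_one, mul_one]

theorem retraction_one (h : IsRationalExtension m G₁ G τ χ) : retraction τ χ 1 = 1 := by
  rw [← map_one (of ℝ N), h.retraction_of (one_mem _)]

theorem retraction_of_mul (h : IsRationalExtension m G₁ G τ χ) {w : N} (hw : w ∈ G)
    {y : MonoidAlgebra ℝ N} (hy : y ∈ Submodule.span ℝ (of ℝ N '' G)) :
    retraction τ χ (of ℝ N w * y) =
      of ℝ N (w * (τ (χ w))⁻¹) * conjAlg (τ (χ w)) (retraction τ χ y) := by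
  induction hy using Submodule.span_induction with
  | mem y hy =>
    obtain ⟨g, hg, rfl⟩ := hy
    rw [← _root_.map_mul, retraction, linLift_of, linLift_of, conjAlg_of, ← _root_.map_mul,
      h.map_mul w hw g hg, τ.map_mul]
    congr 1
    group
  | zero => simp
  | add x y _ _ hx hy => simp only [mul_add, map_add, hx, hy]
  | smul a x _ hx => simp only [mul_smul_comm, map_smul, hx]

theorem of_mul_conjAlg_sub_mem (h : IsRationalExtension m G₁ G τ χ) [G₁.Normal] {w : N} {i k : ℕ}
    (hw : w ∈ G) (hwi : w ∈ lcs N i) {y : MonoidAlgebra ℝ N} (hy : y ∈ weightSpan G₁ k) :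
    of ℝ N (w * (τ (χ w))⁻¹) * conjAlg (τ (χ w)) y - y ∈ weightSpan G₁ (k + i + 1) := by
  rcases le_or_gt i m with him | him
  · have hconj := conjAlg_sub_mem_weightSpan (h.mem_lcs (χ w)) hy
    have hconj' : conjAlg (τ (χ w)) y ∈ weightSpan G₁ k := by
      simpa using add_mem (weightSpan_antitone G₁ (show k ≤ k + m + 1 by omega) hconj) hy
    have hleft := sub_one_mul_mem_weightSpan (h.mul_inv_mem w hw)
      (mul_mem (h.le_lcs hw) (inv_mem (h.mem_lcs (χ w)))) hconj'
    refine weightSpan_antitone G₁ (show k + i + 1 ≤ k + m + 1 by omega) ?_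
    simpa [sub_mul] using add_mem hleft hconj
  · have hwG₁ : w ∈ G₁ := h.lcs_le (lcs_antitone him hwi)
    have hmem := sub_one_mul_mem_weightSpan hwG₁ hwi hy
    rwa [h.map_eq_one hwG₁, map_one τ, inv_one, mul_one, conjAlg_apply, inv_one, map_one, one_mul,
      mul_one, ← sub_one_mul]

theorem retraction_mem_weightSpan (h : IsRationalExtension m G₁ G τ χ) [G₁.Normal] {k : ℕ}
    {y : MonoidAlgebra ℝ N} (hy : y ∈ weightSpan G k) : retraction τ χ y ∈ weightSpan G₁ k := by
  have hmon : ∀ l y, WeightMonomial G l y → retraction τ χ y ∈ weightSpan G₁ l := by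
    intro l y hy
    induction hy with
    | one => rw [h.retraction_one]; exact WeightMonomial.one.mem_weightSpan
    | step hG hw hy ih =>
      rw [sub_mul, one_mul, map_sub, h.retraction_of_mul hG hy.mem_span_of]
      exact h.of_mul_conjAlg_sub_mem hG hw ih
  refine (Submodule.span_le.mpr ?_ : _ ≤ (weightSpan G₁ k).comap (retraction τ χ)) hy
  rintro y ⟨l, hl, hy⟩
  exact weightSpan_antitone G₁ hl (hmon l y hy)

theorem separated (h : IsRationalExtension m G₁ G τ χ) (hmc : m < c) (hsep : Separated c G₁) :
    Separated c G := fun g hg hmem => by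
  have := normal_of_lcs_le h.lcs_le (h.le.trans h.le_lcs)
  have hg₁ : g ∈ G₁ := h.mem_of_sub_one_mem hmc hg hmem
  refine hsep g hg₁ ?_
  have hret := h.retraction_mem_weightSpan hmem
  rwa [map_sub, h.retraction_of hg₁, h.retraction_one] at hret

end IsRationalExtension

end Separated

section RationalExtension

variable {N : Type*} [Group N] {G₁ : Subgroup N} {m : ℕ}

theorem exists_commute_isRadicable_subgroup (hrad : IsRadicable N) (t : N) :
    ∃ A : Subgroup N, t ∈ A ∧ (∀ x y : A, x * y = y * x) ∧ IsRadicable A := by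
  choose root hroot using fun (n : N) (k : ℕ) => hrad n (k + 1) k.succ_pos
  let s : ℕ → N := Nat.rec t fun k x => root x k
  have hs : ∀ k, s (k + 1) ^ (k + 1) = s k := fun k => hroot (s k) k
  have hmono : Monotone fun n => Subgroup.zpowers (s n) := monotone_nat_of_le_succ fun n => by
    rw [Subgroup.zpowers_le, ← hs n]
    exact pow_mem (Subgroup.mem_zpowers _) _
  have hmem : ∀ {x : N}, x ∈ ⨆ n, Subgroup.zpowers (s n) ↔ ∃ n, x ∈ Subgroup.zpowers (s n) :=
    Subgroup.mem_iSup_of_directed hmono.directed_le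
  refine ⟨⨆ n, Subgroup.zpowers (s n), hmem.mpr ⟨0, Subgroup.mem_zpowers _⟩, ?_, ?_⟩
  · rintro ⟨x, hx⟩ ⟨y, hy⟩
    obtain ⟨i, hi⟩ := hmem.mp hx
    obtain ⟨j, hj⟩ := hmem.mp hy
    obtain ⟨a, rfl⟩ := hmono (le_max_left i j) hi
    obtain ⟨b, rfl⟩ := hmono (le_max_right i j) hj
    exact Subtype.ext (zpow_mul_comm _ a b)
  · rintro ⟨x, hx⟩ k hk
    obtain ⟨n, hn⟩ := hmem.mp hx
    have hle : n ≤ k * n + (k - 1) := (Nat.le_mul_of_pos_left n hk).trans (Nat.le_add_right _ _)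
    obtain ⟨a, rfl⟩ := hmono hle hn
    have hindex : k * n + (k - 1) + 1 = k * (n + 1) := by rw [mul_add]; omega
    refine ⟨⟨(s (k * n + (k - 1) + 1) ^ (n + 1)) ^ a,
      hmem.mpr ⟨k * n + (k - 1) + 1, zpow_mem (pow_mem (Subgroup.mem_zpowers _) _) a⟩⟩,
      Subtype.ext ?_⟩
    have hs' := hs (k * n + (k - 1))
    rw [hindex, pow_mul'] at hs'
    change ((s (k * n + (k - 1) + 1) ^ (n + 1)) ^ a) ^ k = s (k * n + (k - 1)) ^ a
    rw [hindex, ← hs', ← zpow_natCast, ← zpow_mul, mul_comm a, zpow_mul, zpow_natCast]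

/-- A divisible abelian group is injective, so `ℤ → A` extends to `ℚ`. -/
theorem exists_rat_oneParameter (hrad : IsRadicable N) (t : N) :
    ∃ τ : Multiplicative ℚ →* N, τ (.ofAdd 1) = t := by
  obtain ⟨A, ht, hcomm, hA⟩ := exists_commute_isRadicable_subgroup hrad t
  let : CommGroup A := { (inferInstance : Group A) with mul_comm := hcomm }
  let : DivisibleBy (Additive A) ℕ := divisibleByOfSMulRightSurj _ _ fun {k} hk x =>
    (hA x.toMul k (Nat.pos_of_ne_zero hk)).imp fun _ hy => congrArg Additive.ofMul hy
  let : DivisibleBy (Additive A) ℤ := AddGroup.divisibleByIntOfDivisibleByNat _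
  obtain ⟨f, hf⟩ := (Module.Baer.of_divisible (Additive A)).extension_property_addMonoidHom
    (Int.castAddHom ℚ) Int.cast_injective (zmultiplesHom _ (Additive.ofMul (⟨t, ht⟩ : A)))
  refine ⟨A.subtype.comp (AddMonoidHom.toMultiplicativeLeft f), ?_⟩
  have hf1 := DFunLike.congr_fun hf 1
  simpa using congrArg (fun x : Additive A => (x.toMul : N)) hf1

variable {τ : Multiplicative ℚ →* N}

theorem rat_oneParameter_pow_den (τ : Multiplicative ℚ →* N) (q : ℚ) :
    τ (.ofAdd q) ^ q.den = τ (.ofAdd 1) ^ q.num := by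
  rw [← map_pow, ← map_zpow, ← ofAdd_nsmul, ← ofAdd_zsmul, nsmul_eq_mul, zsmul_one,
    mul_comm, Rat.mul_den_eq_num]

theorem IsIsolated.rat_oneParameter_mem {G : Subgroup N} (hG : IsIsolated G)
    (h : τ (.ofAdd 1) ∈ G) (q : Multiplicative ℚ) : τ q ∈ G :=
  hG q.toAdd.den_pos (by
    change τ (.ofAdd q.toAdd) ^ _ ∈ G
    rw [rat_oneParameter_pow_den]
    exact zpow_mem h _)

theorem IsIsolated.rat_oneParameter_injective [G₁.Normal] (hG₁ : IsIsolated G₁)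
    (h : τ (.ofAdd 1) ∉ G₁) :
    Function.Injective ((QuotientGroup.mk' G₁).comp τ) := by
  refine (injective_iff_map_eq_one _).mpr fun q hq => ?_
  by_contra hne
  have hpow : τ (.ofAdd 1) ^ q.toAdd.num ∈ G₁ := by
    rw [← rat_oneParameter_pow_den]
    exact pow_mem ((QuotientGroup.eq_one_iff _).mp hq) _
  have hnum : q.toAdd.num ≠ 0 := Rat.num_ne_zero.mpr hne
  refine h (hG₁ (Int.natAbs_pos.mpr hnum) ?_)
  rcases Int.natAbs_eq q.toAdd.num with hq | hq <;> rw [hq] at hpow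
  · exact_mod_cast hpow
  · rwa [zpow_neg, inv_mem_iff, zpow_natCast] at hpow

/-- The extension of `G₁` by the one-parameter subgroup `τ` inside the `m`-th factor of the lower
central series. -/
def rationalExtension (m : ℕ) (G₁ : Subgroup N) [G₁.Normal] (τ : Multiplicative ℚ →* N) :
    Subgroup N :=
  lcs N m ⊓ ((QuotientGroup.mk' G₁).comp τ).range.comap (QuotientGroup.mk' G₁)

theorem isRationalExtension_rationalExtension [G₁.Normal] (hlcs : lcs N (m + 1) ≤ G₁)
    (hle : G₁ ≤ lcs N m) (hτ : ∀ q, τ q ∈ lcs N m)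
    (hinj : Function.Injective ((QuotientGroup.mk' G₁).comp τ)) :
    IsRationalExtension m G₁ (rationalExtension m G₁ τ) τ
      fun g => Function.invFun ((QuotientGroup.mk' G₁).comp τ) g := by
  set σ := (QuotientGroup.mk' G₁).comp τ
  have hspec : ∀ g ∈ rationalExtension m G₁ τ, σ (Function.invFun σ (g : N ⧸ G₁)) = g :=
    fun g hg => Function.invFun_eq hg.2
  refine ⟨hlcs, fun g hg => ⟨hle hg, 1, ?_⟩, inf_le_left, hτ, fun g hg h hh => hinj ?_,
    fun g hg => ?_, fun g hg => ?_⟩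
  · rw [map_one]
    exact ((QuotientGroup.eq_one_iff g).mpr hg).symm
  · rw [map_mul, hspec g hg, hspec h hh, hspec _ (mul_mem hg hh), QuotientGroup.mk_mul]
  · rw [← QuotientGroup.eq_one_iff, ← map_eq_one_iff σ hinj, hspec g hg]
  · rw [← QuotientGroup.eq_one_iff, QuotientGroup.mk_mul, QuotientGroup.mk_inv, mul_inv_eq_one]
    exact (hspec g hg).symm

theorem isIsolated_rationalExtension [G₁.Normal] (hlcs : lcs N (m + 1) ≤ G₁)
    (hm : IsIsolated (lcs N m)) (hG₁ : IsIsolated G₁) :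
    IsIsolated (rationalExtension m G₁ τ) := by
  rintro x k hk ⟨hxm, q, hq⟩
  have hx : x ∈ lcs N m := hm hk hxm
  have hk0 : (k : ℚ) ≠ 0 := Nat.cast_ne_zero.mpr hk.ne'
  let r : Multiplicative ℚ := .ofAdd (q.toAdd / k)
  have hr : r ^ k = q := by
    rw [← ofAdd_nsmul, nsmul_eq_mul, mul_div_cancel₀ _ hk0, ofAdd_toAdd]
  have hpow : ((x * (τ r)⁻¹ : N) : N ⧸ G₁) ^ k = 1 := by
    rw [QuotientGroup.mk_mul, (mk_commute_of_mem_lcs hlcs hx _).mul_pow, QuotientGroup.mk_inv,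
      inv_pow, mul_inv_eq_one, ← QuotientGroup.mk_pow, ← QuotientGroup.mk_pow, ← map_pow, hr]
    exact hq.symm
  have hmem : x * (τ r)⁻¹ ∈ G₁ := hG₁ hk ((QuotientGroup.eq_one_iff _).mp hpow)
  refine ⟨hx, r, ?_⟩
  rw [← QuotientGroup.eq_one_iff, QuotientGroup.mk_mul, QuotientGroup.mk_inv,
    mul_inv_eq_one] at hmem
  exact hmem.symm

theorem Separated.exists_lt {c : ℕ} (hmc : m < c) (hrad : IsRadicable N)
    (hm : IsIsolated (lcs N m)) (hlcs : lcs N (m + 1) ≤ G₁) (hle : G₁ ≤ lcs N m)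
    (hG₁ : IsIsolated G₁) (hsep : Separated c G₁) {t : N} (ht : t ∈ lcs N m) (ht₁ : t ∉ G₁) :
    ∃ G, G₁ < G ∧ G ≤ lcs N m ∧ IsIsolated G ∧ Separated c G := by
  have := normal_of_lcs_le hlcs hle
  obtain ⟨τ, rfl⟩ := exists_rat_oneParameter hrad t
  have hext := isRationalExtension_rationalExtension hlcs hle (hm.rat_oneParameter_mem ht)
    (hG₁.rat_oneParameter_injective ht₁)
  exact ⟨rationalExtension m G₁ τ, SetLike.lt_iff_le_and_exists.mpr
    ⟨hext.le, τ (.ofAdd 1), ⟨ht, .ofAdd 1, rfl⟩, ht₁⟩, hext.le_lcs,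
    isIsolated_rationalExtension hlcs hm hG₁, hext.separated hmc hsep⟩

end RationalExtension

section Chains

variable {N : Type*} [Group N] {C : Set (Subgroup N)}

theorem WeightMonomial.exists_mem_of_sSup (hne : C.Nonempty) (hC : IsChain (· ≤ ·) C) {k : ℕ}
    {y : MonoidAlgebra ℝ N} (hy : WeightMonomial (sSup C) k y) :
    ∃ G ∈ C, WeightMonomial G k y := by
  induction hy with
  | one => exact hne.imp fun _ hG => ⟨hG, .one⟩
  | step hG hw _ ih =>
    obtain ⟨G, hGC, hwG⟩ := (Subgroup.mem_sSup_of_directedOn hne hC.directedOn).mp hG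
    obtain ⟨G', hGC', hy⟩ := ih
    rcases hC.total hGC hGC' with hle | hle
    · exact ⟨G', hGC', .step (hle hwG) hw hy⟩
    · exact ⟨G, hGC, .step hwG hw (hy.mono hle)⟩

theorem exists_mem_weightSpan_of_sSup (hne : C.Nonempty) (hC : IsChain (· ≤ ·) C) {k : ℕ}
    {y : MonoidAlgebra ℝ N} (hy : y ∈ weightSpan (sSup C) k) : ∃ G ∈ C, y ∈ weightSpan G k := by
  have hdir : DirectedOn (· ≤ ·) ((weightSpan · k) '' C) :=
    hC.directedOn.mono_comp fun _ _ hle => weightSpan_mono hle k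
  have hle : weightSpan (sSup C) k ≤ sSup ((weightSpan · k) '' C) := by
    refine Submodule.span_le.mpr ?_
    rintro y ⟨l, hl, hy⟩
    obtain ⟨G, hG, hy⟩ := hy.exists_mem_of_sSup hne hC
    exact le_sSup (Set.mem_image_of_mem (weightSpan · k) hG)
      (weightSpan_antitone G hl hy.mem_weightSpan)
  simpa using (Submodule.mem_sSup_of_directed (hne.image _) hdir).mp (hle hy)

theorem separated_sSup {c : ℕ} (hne : C.Nonempty) (hC : IsChain (· ≤ ·) C)
    (h : ∀ G ∈ C, Separated c G) : Separated c (sSup C) := fun x hx hmem => by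
  obtain ⟨G, hG, hxG⟩ := (Subgroup.mem_sSup_of_directedOn hne hC.directedOn).mp hx
  obtain ⟨G', hG', hmem⟩ := exists_mem_weightSpan_of_sSup hne hC hmem
  rcases hC.total hG hG' with hle | hle
  · exact h G' hG' x (hle hxG) hmem
  · exact h G hG x hxG (weightSpan_mono hle _ hmem)

theorem isIsolated_sSup (hne : C.Nonempty) (hC : IsChain (· ≤ ·) C)
    (h : ∀ G ∈ C, IsIsolated G) : IsIsolated (sSup C) := fun x k hk hx => by
  rw [Subgroup.mem_sSup_of_directedOn hne hC.directedOn] at hx ⊢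
  exact hx.imp fun G hG => ⟨hG.1, h G hG.1 hk hG.2⟩

end Chains

section Embedding

variable {N : Type*} [Group N]

/-- Take a maximal isolated separated subgroup between the two terms: were it not `lcs N m`, a
rational one-parameter subgroup could be added to it. -/
theorem Separated.lcs_of_succ {c m : ℕ} (hmc : m < c) (hrad : IsRadicable N)
    (hiso : ∀ j, IsIsolated (lcs N j)) (hsep : Separated c (lcs N (m + 1))) :
    Separated c (lcs N m) := by
  let S : Set (Subgroup N) :=
    {G | lcs N (m + 1) ≤ G ∧ G ≤ lcs N m ∧ IsIsolated G ∧ Separated c G}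
  have hS : lcs N (m + 1) ∈ S := ⟨le_rfl, lcs_antitone m.le_succ, hiso _, hsep⟩
  obtain ⟨G, -, hmax⟩ := zorn_le_nonempty₀ S (fun C hCS hC G₀ hG₀ => ⟨sSup C,
    ⟨(hCS hG₀).1.trans (le_sSup hG₀), sSup_le fun G hG => (hCS hG).2.1,
      isIsolated_sSup ⟨G₀, hG₀⟩ hC fun G hG => (hCS hG).2.2.1,
      separated_sSup ⟨G₀, hG₀⟩ hC fun G hG => (hCS hG).2.2.2⟩,
    fun G hG => le_sSup hG⟩) _ hS
  obtain ⟨hlcs, hle, hG, hGsep⟩ := hmax.prop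
  suffices G = lcs N m from this ▸ hGsep
  refine hle.antisymm fun t ht => ?_
  by_contra ht₁
  obtain ⟨G', hlt, hG'⟩ := hGsep.exists_lt hmc hrad (hiso m) hlcs hle hG ht ht₁
  exact hlt.not_ge (hmax.le_of_ge ⟨hlcs.trans hlt.le, hG'⟩ hlt.le)

variable [Group.IsNilpotent N]

theorem separated_lcs (htf : IsIsolated (⊥ : Subgroup N)) (hrad : IsRadicable N) {m : ℕ}
    (hm : m ≤ Group.nilpotencyClass N) : Separated (Group.nilpotencyClass N) (lcs N m) := by
  induction hm using Nat.decreasingInduction with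
  | self =>
    intro h hh _
    rwa [lcs_nilpotencyClass] at hh
  | of_succ m hm ih => exact ih.lcs_of_succ hm hrad (isIsolated_lcs htf hrad)

theorem toTrunc_injective (htf : IsIsolated (⊥ : Subgroup N)) (hrad : IsRadicable N) :
    Function.Injective (toTrunc N) := by
  refine (injective_iff_map_eq_one _).mpr fun n hn => ?_
  have hmem : MonoidAlgebra.of ℝ N n - 1 ∈ augIdeal N ^ (Group.nilpotencyClass N + 1) := by
    rw [← Ideal.Quotient.eq_zero_iff_mem, map_sub, map_one, sub_eq_zero]
    exact hn
  exact separated_lcs htf hrad (Nat.zero_le _) n (mem_lcs_zero n)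
    (mem_weightSpan_top_of_mem_augIdeal_pow hmem)

end Embedding

section PolynomialCurves

variable {R V W X : Type*} [CommRing R] [AddCommGroup V] [Module R V] [AddCommGroup W] [Module R W]
  [AddCommGroup X] [Module R X]

/-- A curve `R → V` in a module is polynomial if it has the form `t ↦ ∑ k, t ^ k • a k` for finitely
many coefficients `a k` in `V`. -/
def IsPoly (g : R → V) : Prop :=
  ∃ a : ℕ →₀ V, ∀ t, g t = a.sum fun k v => t ^ k • v

namespace IsPoly

theorem monomial (k : ℕ) (v : V) : IsPoly fun t : R => t ^ k • v :=
  ⟨Finsupp.single k v, fun t =>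
    (Finsupp.sum_single_index (h := fun k v => t ^ k • v) (smul_zero _)).symm⟩

theorem const (v : V) : IsPoly fun _ : R => v := by
  simpa only [pow_zero, one_smul] using monomial (R := R) 0 v

theorem id : IsPoly fun t : R => t := by
  simpa only [pow_one, smul_eq_mul, mul_one] using monomial (R := R) 1 (1 : R)

theorem add {f g : R → V} (hf : IsPoly f) (hg : IsPoly g) : IsPoly fun t => f t + g t := by
  obtain ⟨a, ha⟩ := hf
  obtain ⟨b, hb⟩ := hg
  refine ⟨a + b, fun t => ?_⟩
  simp only [ha, hb]
  rw [Finsupp.sum_add_index' (fun _ => smul_zero _) fun _ _ _ => smul_add _ _ _]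

theorem sum {ι : Type*} (s : Finset ι) {f : ι → R → V} (h : ∀ i ∈ s, IsPoly (f i)) :
    IsPoly fun t => ∑ i ∈ s, f i t := by
  classical
  induction s using Finset.induction_on with
  | empty => simpa only [Finset.sum_empty] using const (0 : V)
  | insert i s hi ih =>
    simp only [Finset.sum_insert hi]
    exact (h i (Finset.mem_insert_self i s)).add (ih fun j hj => h j (Finset.mem_insert_of_mem hj))

theorem map {g : R → V} (hg : IsPoly g) (L : V →ₗ[R] W) : IsPoly fun t => L (g t) := by
  obtain ⟨a, ha⟩ := hg
  simp only [ha, Finsupp.sum, map_sum, map_smul]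
  exact sum _ fun k _ => monomial k _

theorem map₂ (B : V →ₗ[R] W →ₗ[R] X) {f : R → V} {g : R → W} (hf : IsPoly f) (hg : IsPoly g) :
    IsPoly fun t => B (f t) (g t) := by
  obtain ⟨a, ha⟩ := hf
  obtain ⟨b, hb⟩ := hg
  simp only [ha, hb, Finsupp.sum, map_sum, map_smul, LinearMap.sum_apply, LinearMap.smul_apply,
    smul_smul, Finset.smul_sum, ← pow_add]
  exact sum _ fun _ _ => sum _ fun _ _ => monomial _ _

theorem neg {g : R → V} (hg : IsPoly g) : IsPoly fun t => -g t :=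
  hg.map (-LinearMap.id : V →ₗ[R] V)

theorem sub {f g : R → V} (hf : IsPoly f) (hg : IsPoly g) : IsPoly fun t => f t - g t := by
  simpa only [sub_eq_add_neg] using hf.add hg.neg

theorem smul {f : R → R} {g : R → V} (hf : IsPoly f) (hg : IsPoly g) : IsPoly fun t => f t • g t :=
  map₂ (LinearMap.lsmul R V) hf hg

variable {A : Type*} [Ring A] [Algebra R A]

theorem mul {f g : R → A} (hf : IsPoly f) (hg : IsPoly g) : IsPoly fun t => f t * g t :=
  map₂ (LinearMap.mul R A) hf hg

theorem pow {f : R → A} (hf : IsPoly f) (k : ℕ) : IsPoly fun t => f t ^ k := by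
  induction k with
  | zero => simpa only [pow_zero] using const (1 : A)
  | succ k ih => simpa only [pow_succ] using ih.mul hf

theorem choose {q : ℝ → ℝ} (hq : IsPoly q) (k : ℕ) : IsPoly fun t => Ring.choose (q t) k := by
  simp only [Ring.choose_eq_smul, Polynomial.smeval_eq_sum, Polynomial.sum, Polynomial.smul_pow]
  exact (const (_ : ℝ)).smul (sum _ fun i _ =>
    (hq.pow i).map ((descPochhammer ℤ k).coeff i • LinearMap.id))

theorem binomialSum {B : Type*} [Ring B] [Algebra ℝ B] {q : ℝ → ℝ} (hq : IsPoly q) (c : ℕ)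
    (a : B) : IsPoly fun t => binomialSum c a (q t) :=
  sum _ fun k _ => (hq.choose k).smul (const _)

end IsPoly

variable {k U : Type*} [Field k] [CharZero k] [AddCommGroup U] [Module k U]

theorem coeff_mem_of_forall_nat {S : Submodule k U} {a : ℕ →₀ U}
    (h : ∀ n : ℕ, (a.sum fun i v => (n : k) ^ i • v) ∈ S) (i : ℕ) : a i ∈ S := by
  by_contra hi
  obtain ⟨f, hf, hS⟩ := S.exists_le_ker_of_notMem hi
  let p : Polynomial k := ∑ j ∈ a.support, Polynomial.monomial j (f (a j))
  have hp : ∀ t, p.eval t = f (a.sum fun j v => t ^ j • v) := fun t => by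
    simp only [p, Polynomial.eval_finsetSum, Polynomial.eval_monomial, Finsupp.sum, map_sum,
      map_smul, smul_eq_mul, mul_comm]
  have hp₀ : p = 0 := by
    refine Polynomial.eq_zero_of_infinite_isRoot p
      ((Set.infinite_range_of_injective (Nat.cast_injective (R := k))).mono ?_)
    rintro _ ⟨n, rfl⟩
    exact (hp n).trans (hS (h n))
  have hcoeff : p.coeff i = f (a i) := by
    simp only [p, Polynomial.finsetSum_coeff, Polynomial.coeff_monomial, Finset.sum_ite_eq']
    exact ite_eq_left_iff.mpr fun h₀ => by rw [Finsupp.notMem_support_iff.mp h₀, map_zero]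
  exact hf (by rw [← hcoeff, hp₀, Polynomial.coeff_zero])

theorem IsPoly.mem_of_forall_nat {S : Submodule k U} {g : k → U} (hg : IsPoly g)
    (h : ∀ n : ℕ, g n ∈ S) (t : k) : g t ∈ S := by
  obtain ⟨a, ha⟩ := hg
  simp only [ha] at h ⊢
  exact sum_mem fun i _ => S.smul_mem _ (coeff_mem_of_forall_nat h i)

theorem IsPoly.eq_of_forall_nat {f g : k → U} (hf : IsPoly f) (hg : IsPoly g)
    (h : ∀ n : ℕ, f n = g n) (t : k) : f t = g t := by
  rw [← sub_eq_zero, ← Submodule.mem_bot k]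
  exact (hf.sub hg).mem_of_forall_nat (fun n => (Submodule.mem_bot k).mpr (sub_eq_zero.mpr (h n))) t

end PolynomialCurves

section Coefficients

open MonoidAlgebra (of)

variable {N : Type*} [Group N]

theorem mem_of_mem_augIdeal_pow_succ {S : AddSubgroup (MonoidAlgebra ℝ N)} {k : ℕ}
    (h : ∀ r ∈ augIdeal N ^ k, ∀ n : N, r * (of ℝ N n - 1) ∈ S) {x : MonoidAlgebra ℝ N}
    (hx : x ∈ augIdeal N ^ (k + 1)) : x ∈ S := by
  rw [Submodule.pow_succ] at hx
  refine Submodule.mul_induction_on hx (fun r hr y hy => ?_) fun _ _ => S.add_mem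
  replace hy := mem_span_of_mem_augIdeal hy
  induction hy using Submodule.span_induction generalizing r with
  | mem y hy =>
    obtain ⟨n, rfl⟩ := hy
    exact h r hr n
  | zero => simpa only [mul_zero] using zero_mem S
  | add y z _ _ ihy ihz =>
    rw [mul_add]
    exact add_mem (ihy r hr) (ihz r hr)
  | smul a y _ ih =>
    rw [mul_smul_comm, ← smul_mul_assoc]
    exact ih (a • r) (Submodule.smul_of_tower_mem _ a hr)

theorem map_mul_of (ρ : ℝ →+ ℝ) (x : MonoidAlgebra ℝ N) (n : N) :
    MonoidAlgebra.map ρ (x * of ℝ N n) = MonoidAlgebra.map ρ x * of ℝ N n := by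
  induction x using MonoidAlgebra.induction_linear with
  | zero => simp
  | add x y hx hy => rw [add_mul, MonoidAlgebra.map_add, MonoidAlgebra.map_add, hx, hy, add_mul]
  | single m r => simp

theorem map_mem_augIdeal_pow (ρ : ℝ →+ ℝ) {k : ℕ} {x : MonoidAlgebra ℝ N}
    (hx : x ∈ augIdeal N ^ k) : MonoidAlgebra.map ρ x ∈ augIdeal N ^ k := by
  induction k generalizing x with
  | zero => simp only [Submodule.pow_zero, Ideal.one_eq_top, Submodule.mem_top]
  | succ k ih =>
    let f : MonoidAlgebra ℝ N →+ MonoidAlgebra ℝ N :=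
      ⟨⟨MonoidAlgebra.map ρ, MonoidAlgebra.map_zero ρ⟩, MonoidAlgebra.map_add ρ⟩
    refine mem_of_mem_augIdeal_pow_succ (S := (augIdeal N ^ (k + 1)).toAddSubgroup.comap f)
      (fun r hr n => ?_) hx
    have hf : f (r * (of ℝ N n - 1)) = f r * (of ℝ N n - 1) := by
      rw [mul_sub, mul_one, map_sub, mul_sub, mul_one]
      exact congrArg (· - f r) (map_mul_of ρ r n)
    change f (r * (of ℝ N n - 1)) ∈ augIdeal N ^ (k + 1)
    rw [hf, Submodule.pow_succ]
    exact Ideal.mul_mem_mul (ih hr) (of_sub_one_mem_augIdeal n)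

end Coefficients

section Filtration

variable {N : Type*} [Group N] [Group.IsNilpotent N]

variable (N) in
/-- The filtration of `TruncAlgebra N` by the images of the powers of the augmentation ideal. -/
noncomputable def truncFiltration (i : ℕ) : Submodule ℝ (TruncAlgebra N) :=
  ((augIdeal N ^ i).restrictScalars ℝ).map
    (Ideal.Quotient.mkₐ ℝ (augIdeal N ^ (Group.nilpotencyClass N + 1))).toLinearMap

theorem truncFiltration_zero : truncFiltration N 0 = ⊤ := by
  rw [truncFiltration, Submodule.pow_zero, Ideal.one_eq_top, Submodule.restrictScalars_top,
    Submodule.map_top, LinearMap.range_eq_top]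
  exact Ideal.Quotient.mk_surjective

theorem truncFiltration_succ_le (i : ℕ) : truncFiltration N (i + 1) ≤ truncFiltration N i :=
  Submodule.map_mono fun _ hx => Ideal.pow_le_pow_right i.le_succ hx

theorem truncFiltration_nilpotencyClass_succ :
    truncFiltration N (Group.nilpotencyClass N + 1) = ⊥ := by
  refine (Submodule.eq_bot_iff _).mpr ?_
  rintro _ ⟨x, hx, rfl⟩
  exact Ideal.Quotient.eq_zero_iff_mem.mpr hx

theorem mul_mem_truncFiltration {i j : ℕ} {a b : TruncAlgebra N} (ha : a ∈ truncFiltration N i)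
    (hb : b ∈ truncFiltration N j) : a * b ∈ truncFiltration N (i + j) := by
  obtain ⟨x, hx, rfl⟩ := ha
  obtain ⟨y, hy, rfl⟩ := hb
  refine ⟨x * y, ?_, map_mul (Ideal.Quotient.mkₐ ℝ _) x y⟩
  change x * y ∈ augIdeal N ^ (i + j)
  rw [Ideal.IsTwoSided.pow_add]
  exact Ideal.mul_mem_mul hx hy

theorem toTrunc_sub_one_mem (n : N) : toTrunc N n - 1 ∈ truncFiltration N 1 :=
  ⟨MonoidAlgebra.of ℝ N n - 1, (Submodule.pow_one (augIdeal N)).ge (of_sub_one_mem_augIdeal n), rfl⟩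

/-- The additive map of `TruncAlgebra N` that applies an additive map `ρ : ℝ → ℝ` to the
coefficients. -/
noncomputable def truncCoeff (ρ : ℝ →+ ℝ) : TruncAlgebra N →+ TruncAlgebra N :=
  QuotientAddGroup.map _ _
    ⟨⟨MonoidAlgebra.map ρ, MonoidAlgebra.map_zero ρ⟩, MonoidAlgebra.map_add ρ⟩
    fun _ hx => map_mem_augIdeal_pow ρ hx

theorem truncCoeff_mem_truncFiltration (ρ : ℝ →+ ℝ) {i : ℕ} {a : TruncAlgebra N}
    (ha : a ∈ truncFiltration N i) : truncCoeff ρ a ∈ truncFiltration N i := by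
  obtain ⟨x, hx, rfl⟩ := ha
  exact ⟨_, map_mem_augIdeal_pow ρ hx, rfl⟩

theorem truncCoeff_smul_toTrunc (ρ : ℝ →+ ℝ) (r : ℝ) (n : N) :
    truncCoeff ρ (r • toTrunc N n) = ρ r • toTrunc N n := by
  have hmap : MonoidAlgebra.map ρ (r • MonoidAlgebra.of ℝ N n) = ρ r • MonoidAlgebra.of ℝ N n := by
    simp
  exact congrArg (Ideal.Quotient.mk (augIdeal N ^ (Group.nilpotencyClass N + 1))) hmap

end Filtration

theorem exists_coordinate_functional {K V ι : Type*} [Field K] [AddCommGroup V] [Module K V]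
    {s : ι → V} (hs : LinearIndependent K s) (l : ι) :
    ∃ f : V →ₗ[K] K, f (s l) = 1 ∧ ∀ j, j ≠ l → f (s j) = 0 := by
  obtain ⟨f, hf⟩ := ((Finsupp.lapply l).comp hs.repr).exists_extend
  have hs' : ∀ j, f (s j) = hs.repr ⟨s j, Submodule.subset_span ⟨j, rfl⟩⟩ l := fun j =>
    LinearMap.congr_fun hf ⟨s j, Submodule.subset_span ⟨j, rfl⟩⟩
  simp only [hs.repr_eq_single _ ⟨_, _⟩ rfl] at hs'
  exact ⟨f, by simp [hs'], fun j hj => by simp [hs', hj]⟩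

noncomputable section

variable {N : Type*} [Group N] [Group.IsNilpotent N]

section RealPowers

/-- The real power `n ^ t` as an element of `N^ℝ`. -/
def rpow (n : N) (t : ℝ) : RealCompletion N := ⟨realPow n t, realPow_mem n t⟩

/-- The inclusion of `N^ℝ` into the truncated group algebra. -/
def toAlg : RealCompletion N →* TruncAlgebra N :=
  (Units.coeHom _).comp (RealCompletion N).subtype

theorem toAlg_injective : Function.Injective (toAlg (N := N)) :=
  fun _ _ h => Subtype.ext (Units.ext h)

theorem toAlg_toReal (n : N) : toAlg (toReal N n) = toTrunc N n := realPow_one n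

theorem realExtension_rpow (φ : N →* N) (n : N) (t : ℝ) :
    realExtension φ (rpow n t) = rpow (φ n) t :=
  realExtension_realPow φ n t

theorem rpow_zero (n : N) : rpow n 0 = 1 := toAlg_injective (binomialSum_zero _ _)

theorem rpow_add (n : N) (s t : ℝ) : rpow n (s + t) = rpow n s * rpow n t :=
  Subtype.ext (realPow_add n s t)

theorem rpow_neg (n : N) (t : ℝ) : rpow n (-t) = (rpow n t)⁻¹ := by
  rw [eq_inv_iff_mul_eq_one, ← rpow_add, neg_add_cancel, rpow_zero]

theorem rpow_natCast (n : N) (k : ℕ) : rpow n k = toReal N (n ^ k) := by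
  induction k with
  | zero => rw [Nat.cast_zero, rpow_zero, pow_zero, map_one]
  | succ k ih =>
    rw [Nat.cast_succ, rpow_add, ih, pow_succ, map_mul]
    rfl

theorem rpow_intCast (n : N) (z : ℤ) : rpow n z = toReal N (n ^ z) := by
  obtain ⟨k, rfl | rfl⟩ := z.eq_nat_or_neg
  · rw [Int.cast_natCast, rpow_natCast, zpow_natCast]
  · rw [Int.cast_neg, Int.cast_natCast, rpow_neg, rpow_natCast, zpow_neg, zpow_natCast, map_inv]

/-- A curve in `N^ℝ` is polynomial if it is so as a curve in the truncated group algebra. -/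
def IsPolyCurve (g : ℝ → RealCompletion N) : Prop := IsPoly fun t => toAlg (g t)

theorem IsPolyCurve.const (u : RealCompletion N) : IsPolyCurve fun _ => u := IsPoly.const _

theorem IsPolyCurve.mul {f g : ℝ → RealCompletion N} (hf : IsPolyCurve f) (hg : IsPolyCurve g) :
    IsPolyCurve fun t => f t * g t := by
  simpa only [IsPolyCurve, map_mul] using IsPoly.mul hf hg

theorem IsPoly.rpow {q : ℝ → ℝ} (hq : IsPoly q) (n : N) : IsPolyCurve fun t => rpow n (q t) :=
  hq.binomialSum _ _

theorem one_rpow (t : ℝ) : rpow (1 : N) t = 1 := by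
  refine toAlg_injective ((IsPoly.id.rpow 1).eq_of_forall_nat (IsPoly.const _) (fun k => ?_) t)
  simp only [rpow_natCast, one_pow, map_one]

end RealPowers

section RealSpan

theorem rpow_mem_realSpan {H : Subgroup N} {h : N} (hh : h ∈ H) (t : ℝ) : rpow h t ∈ realSpan H :=
  Subgroup.subset_closure ⟨h, hh, t, rfl⟩

theorem toReal_mem_realSpan {H : Subgroup N} {h : N} (hh : h ∈ H) : toReal N h ∈ realSpan H :=
  rpow_mem_realSpan hh 1

theorem realSpan_le {H : Subgroup N} {S : Subgroup (RealCompletion N)}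
    (h : ∀ n ∈ H, ∀ t, rpow n t ∈ S) : realSpan H ≤ S := by
  refine (Subgroup.closure_le _).mpr ?_
  rintro _ ⟨n, hn, t, rfl⟩
  exact h n hn t

theorem realSpan_mono {H K : Subgroup N} (h : H ≤ K) : realSpan H ≤ realSpan K :=
  realSpan_le fun _ hn => rpow_mem_realSpan (h hn)

theorem realSpan_top : realSpan (⊤ : Subgroup N) = ⊤ := by
  refine Eq.trans (congrArg Subgroup.closure ?_) (Subgroup.closure_closure_coe_preimage
    (k := {u | ∃ (n : N) (t : ℝ), u = realPow n t}))
  ext u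
  exact ⟨fun ⟨n, _, t, h⟩ => ⟨n, t, congrArg Subtype.val h⟩,
    fun ⟨n, t, h⟩ => ⟨n, Subgroup.mem_top n, t, Subtype.ext h⟩⟩

theorem eq_of_mem_realSpan {G : Type*} [Group G] {H : Subgroup N} {f g : RealCompletion N →* G}
    (h : ∀ n ∈ H, ∀ t, f (rpow n t) = g (rpow n t)) {u : RealCompletion N} (hu : u ∈ realSpan H) :
    f u = g u :=
  realSpan_le (S := f.eqLocus g) h hu

theorem hom_ext {G : Type*} [Group G] {f g : RealCompletion N →* G}
    (h : ∀ n t, f (rpow n t) = g (rpow n t)) : f = g :=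
  MonoidHom.ext fun u =>
    eq_of_mem_realSpan (H := ⊤) (fun n _ => h n) (realSpan_top.ge (Subgroup.mem_top u))

theorem realExtension_id : realExtension (MonoidHom.id N) = MonoidHom.id _ :=
  hom_ext fun n t => realExtension_rpow _ n t

theorem realExtension_one : realExtension (1 : N →* N) = 1 :=
  hom_ext fun n t => (realExtension_rpow _ n t).trans (one_rpow t)

end RealSpan

section Coincidence

/-- The difference of the endomorphisms of the truncated group algebra induced by `φ` and `ψ`. -/
def truncDiff (φ ψ : N →* N) : TruncAlgebra N →ₗ[ℝ] TruncAlgebra N :=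
  (truncMap φ).toLinearMap - (truncMap ψ).toLinearMap

variable (φ ψ : N →* N) {i : ℕ}

theorem truncDiff_toAlg (u : RealCompletion N) : truncDiff φ ψ (toAlg u) =
    toAlg (realExtension φ u) - toAlg (realExtension ψ u) := rfl

theorem truncDiff_toTrunc (n : N) :
    truncDiff φ ψ (toTrunc N n) = toTrunc N (φ n) - toTrunc N (ψ n) :=
  congrArg₂ (· - ·) (truncMap_toTrunc φ n) (truncMap_toTrunc ψ n)

theorem truncDiff_id_one_toAlg (u : RealCompletion N) :
    truncDiff (MonoidHom.id N) 1 (toAlg u) = toAlg u - 1 := by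
  rw [truncDiff_toAlg, realExtension_id, realExtension_one, MonoidHom.one_apply, map_one,
    MonoidHom.id_apply]

theorem truncDiff_toAlg_one : truncDiff φ ψ (toAlg 1) = 0 := by
  rw [truncDiff_toAlg, map_one (realExtension φ), map_one (realExtension ψ), sub_self]

theorem truncDiff_toAlg_mul (u v : RealCompletion N) : truncDiff φ ψ (toAlg (u * v)) =
    truncDiff φ ψ (toAlg u) * toAlg (realExtension φ v) +
      toAlg (realExtension ψ u) * truncDiff φ ψ (toAlg v) := by
  rw [truncDiff_toAlg, truncDiff_toAlg, truncDiff_toAlg, map_mul, map_mul, map_mul, map_mul]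
  noncomm_ring

theorem truncDiff_toAlg_inv (u : RealCompletion N) : truncDiff φ ψ (toAlg u⁻¹) =
    -(toAlg (realExtension ψ u⁻¹) * truncDiff φ ψ (toAlg u) * toAlg (realExtension φ u⁻¹)) := by
  have hφ : toAlg (realExtension φ u) * toAlg (realExtension φ u⁻¹) = 1 := by
    simp only [← map_mul, mul_inv_cancel, map_one]
  have hψ : toAlg (realExtension ψ u⁻¹) * toAlg (realExtension ψ u) = 1 := by
    simp only [← map_mul, inv_mul_cancel, map_one]
  rw [truncDiff_toAlg, truncDiff_toAlg, mul_sub, sub_mul, mul_assoc, hφ, hψ, mul_one, one_mul,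
    neg_sub]

theorem mul_mem_truncFiltration_left (a : TruncAlgebra N) {b : TruncAlgebra N}
    (hb : b ∈ truncFiltration N i) : a * b ∈ truncFiltration N i := by
  simpa only [zero_add] using
    mul_mem_truncFiltration (truncFiltration_zero.ge (Submodule.mem_top (x := a))) hb

theorem mul_mem_truncFiltration_right {a : TruncAlgebra N} (b : TruncAlgebra N)
    (ha : a ∈ truncFiltration N i) : a * b ∈ truncFiltration N i := by
  simpa only [add_zero] using
    mul_mem_truncFiltration ha (truncFiltration_zero.ge (Submodule.mem_top (x := b)))

/-- The subgroup of `N^ℝ` on which `φ^ℝ` and `ψ^ℝ` agree modulo the `i`-th power of the augmentation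
ideal. -/
def realCoincidence (i : ℕ) : Subgroup (RealCompletion N) where
  carrier := {u | truncDiff φ ψ (toAlg u) ∈ truncFiltration N i}
  one_mem' := by
    rw [Set.mem_ofPred_eq, truncDiff_toAlg_one]
    exact zero_mem _
  mul_mem' {u v} hu hv := by
    rw [Set.mem_ofPred_eq, truncDiff_toAlg_mul]
    exact add_mem (mul_mem_truncFiltration_right _ hu) (mul_mem_truncFiltration_left _ hv)
  inv_mem' {u} hu := by
    rw [Set.mem_ofPred_eq, truncDiff_toAlg_inv]
    exact neg_mem (mul_mem_truncFiltration_right _ (mul_mem_truncFiltration_left _ hu))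

/-- The subgroup of `N` on which `φ` and `ψ` agree modulo the `i`-th power of the augmentation
ideal. -/
def coincidence (i : ℕ) : Subgroup N := (realCoincidence φ ψ i).comap (toReal N)

variable {φ ψ}

theorem mem_coincidence {n : N} :
    n ∈ coincidence φ ψ i ↔ truncDiff φ ψ (toTrunc N n) ∈ truncFiltration N i := by
  rw [← toAlg_toReal]
  rfl

theorem coincidence_zero : coincidence φ ψ 0 = ⊤ :=
  eq_top_iff.mpr fun _ _ => truncFiltration_zero.ge Submodule.mem_top

theorem coincidence_succ_le : coincidence φ ψ (i + 1) ≤ coincidence φ ψ i :=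
  fun _ hn => truncFiltration_succ_le i hn

theorem coincidence_nilpotencyClass_succ (h : Function.Injective (toTrunc N)) (φ ψ : N →* N) :
    coincidence φ ψ (Group.nilpotencyClass N + 1) = φ.eqLocus ψ := by
  ext n
  rw [mem_coincidence, truncFiltration_nilpotencyClass_succ, Submodule.mem_bot, truncDiff_toTrunc,
    sub_eq_zero, h.eq_iff]
  rfl

theorem realSpan_coincidence_le : realSpan (coincidence φ ψ i) ≤ realCoincidence φ ψ i :=
  realSpan_le fun n hn t => ((IsPoly.id.rpow n).map (truncDiff φ ψ)).mem_of_forall_nat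
    (S := truncFiltration N i) (fun k => by
      simp only [rpow_natCast]
      exact pow_mem hn k) t

theorem toAlg_sub_one_mem (u : RealCompletion N) : toAlg u - 1 ∈ truncFiltration N 1 := by
  rw [← truncDiff_id_one_toAlg]
  have htop : coincidence (MonoidHom.id N) 1 1 = ⊤ := eq_top_iff.mpr fun n _ => by
    rw [mem_coincidence, ← toAlg_toReal, truncDiff_id_one_toAlg, toAlg_toReal]
    exact toTrunc_sub_one_mem n
  refine realSpan_coincidence_le (φ := MonoidHom.id N) (ψ := 1) (i := 1) ?_
  rw [htop, realSpan_top]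
  exact Subgroup.mem_top u

theorem toAlg_inv (u : RealCompletion N) :
    toAlg u⁻¹ = ∑ k ∈ Finset.range (Group.nilpotencyClass N + 1), (1 - toAlg u) ^ k := by
  have hmem : ∀ k, (1 - toAlg u) ^ k ∈ truncFiltration N k := fun k => by
    induction k with
    | zero => exact truncFiltration_zero.ge Submodule.mem_top
    | succ k ih =>
      rw [pow_succ]
      exact mul_mem_truncFiltration ih (by simpa using neg_mem (toAlg_sub_one_mem u))
  have hzero : (1 - toAlg u) ^ (Group.nilpotencyClass N + 1) = 0 := by
    rw [← Submodule.mem_bot ℝ, ← truncFiltration_nilpotencyClass_succ]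
    exact hmem _
  have hgeom := mul_neg_geom_sum (1 - toAlg u) (Group.nilpotencyClass N + 1)
  rw [sub_sub_cancel, hzero, sub_zero] at hgeom
  exact left_inv_eq_right_inv (by rw [← map_mul, inv_mul_cancel, map_one]) hgeom

theorem IsPolyCurve.inv {g : ℝ → RealCompletion N} (hg : IsPolyCurve g) :
    IsPolyCurve fun t => (g t)⁻¹ := by
  simp only [IsPolyCurve, toAlg_inv]
  exact IsPoly.sum _ fun k _ => ((IsPoly.const 1).sub hg).pow k

theorem IsPolyCurve.commutatorElement {f g : ℝ → RealCompletion N} (hf : IsPolyCurve f)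
    (hg : IsPolyCurve g) : IsPolyCurve fun t => ⁅f t, g t⁆ :=
  ((hf.mul hg).mul hf.inv).mul hg.inv

end Coincidence

section GradedDifference

variable {φ ψ : N →* N} {i : ℕ}

theorem truncDiff_mul_smodEq {u v : RealCompletion N} (hu : u ∈ realCoincidence φ ψ i)
    (hv : v ∈ realCoincidence φ ψ i) : truncDiff φ ψ (toAlg (u * v)) ≡
      truncDiff φ ψ (toAlg u) + truncDiff φ ψ (toAlg v) [SMOD truncFiltration N (i + 1)] := by
  have huv := add_mem (mul_mem_truncFiltration hu (toAlg_sub_one_mem (realExtension φ v)))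
    (add_comm 1 i ▸ mul_mem_truncFiltration (toAlg_sub_one_mem (realExtension ψ u)) hv)
  rw [SModEq.sub_mem, truncDiff_toAlg_mul]
  convert huv using 1
  noncomm_ring

variable (φ ψ i) in
/-- The difference of `φ^ℝ` and `ψ^ℝ` in the `i`-th graded piece of the truncated group algebra. On
`realCoincidence φ ψ i` it turns products into sums, so its target is written multiplicatively. -/
def grDiff :
    realCoincidence φ ψ i →* Multiplicative (TruncAlgebra N ⧸ truncFiltration N (i + 1)) where
  toFun u := .ofAdd (Submodule.Quotient.mk (truncDiff φ ψ (toAlg (u : RealCompletion N))))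
  map_one' := congrArg (fun a => Multiplicative.ofAdd (Submodule.Quotient.mk a))
    (truncDiff_toAlg_one φ ψ)
  map_mul' u v := congrArg Multiplicative.ofAdd (truncDiff_mul_smodEq u.2 v.2)

theorem grDiff_eq_iff {u v : realCoincidence φ ψ i} : grDiff φ ψ i u = grDiff φ ψ i v ↔
    truncDiff φ ψ (toAlg (u : RealCompletion N)) ≡ truncDiff φ ψ (toAlg (v : RealCompletion N))
      [SMOD truncFiltration N (i + 1)] :=
  Iff.rfl

theorem grDiff_eq_one_iff {u : realCoincidence φ ψ i} :
    grDiff φ ψ i u = 1 ↔ (u : RealCompletion N) ∈ realCoincidence φ ψ (i + 1) :=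
  Submodule.Quotient.mk_eq_zero _

theorem inv_mul_mem_realCoincidence_succ {u v : RealCompletion N}
    (hu : u ∈ realCoincidence φ ψ i) (hv : v ∈ realCoincidence φ ψ i)
    (h : truncDiff φ ψ (toAlg u) ≡ truncDiff φ ψ (toAlg v) [SMOD truncFiltration N (i + 1)]) :
    u⁻¹ * v ∈ realCoincidence φ ψ (i + 1) := by
  let u' : realCoincidence φ ψ i := ⟨u, hu⟩
  let v' : realCoincidence φ ψ i := ⟨v, hv⟩
  have huv : grDiff φ ψ i u' = grDiff φ ψ i v' := grDiff_eq_iff.mpr h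
  exact (grDiff_eq_one_iff (u := u'⁻¹ * v')).mp (by rw [map_mul, map_inv, huv, inv_mul_cancel])

theorem truncDiff_pow_smodEq {u : RealCompletion N} (hu : u ∈ realCoincidence φ ψ i) (m : ℕ) :
    truncDiff φ ψ (toAlg (u ^ m)) ≡ (m : ℝ) • truncDiff φ ψ (toAlg u)
      [SMOD truncFiltration N (i + 1)] := by
  induction m with
  | zero => rw [pow_zero, truncDiff_toAlg_one, Nat.cast_zero, zero_smul]
  | succ m ih =>
    rw [pow_succ, Nat.cast_succ, add_smul, one_smul]
    exact (truncDiff_mul_smodEq (pow_mem hu m) hu).trans (ih.add SModEq.rfl)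

theorem truncDiff_rpow_smodEq {k : N} (hk : k ∈ coincidence φ ψ i) (t : ℝ) :
    truncDiff φ ψ (toAlg (rpow k t)) ≡ t • truncDiff φ ψ (toTrunc N k)
      [SMOD truncFiltration N (i + 1)] := by
  refine SModEq.sub_mem.mpr ((((IsPoly.id.rpow k).map (truncDiff φ ψ)).sub
    (IsPoly.id.smul (IsPoly.const _))).mem_of_forall_nat (fun m => SModEq.sub_mem.mp ?_) t)
  simp only [rpow_natCast, map_pow, ← toAlg_toReal]
  exact truncDiff_pow_smodEq hk m

theorem truncDiff_prod_ofFn_smodEq {r : ℕ} {u : Fin r → RealCompletion N}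
    (hu : ∀ l, u l ∈ realCoincidence φ ψ i) : truncDiff φ ψ (toAlg (List.ofFn u).prod) ≡
      ∑ l, truncDiff φ ψ (toAlg (u l)) [SMOD truncFiltration N (i + 1)] := by
  induction r with
  | zero => simp [truncDiff_toAlg_one, -map_one]
  | succ r ih =>
    rw [List.ofFn_succ, List.prod_cons, Fin.sum_univ_succ]
    refine (truncDiff_mul_smodEq (hu 0) (list_prod_mem ?_)).trans
      (SModEq.rfl.add (ih fun l => hu l.succ))
    exact List.forall_mem_ofFn_iff.mpr fun l => hu l.succ

theorem isIsolated_coincidence : IsIsolated (coincidence φ ψ i) := fun k m hm hk => by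
  induction i with
  | zero => exact coincidence_zero.ge (Subgroup.mem_top k)
  | succ i ih =>
    have hsmul := (truncDiff_pow_smodEq (ih (coincidence_succ_le hk)) m).symm.trans
      (SModEq.zero.mpr (by rwa [← map_pow]))
    rw [mem_coincidence, ← toAlg_toReal]
    exact ((truncFiltration N (i + 1)).smul_mem_iff (Nat.cast_ne_zero.mpr hm.ne')).mp
      (SModEq.zero.mp hsmul)

theorem commutator_le_inf_coincidence {K : Subgroup N} (hK : K ≤ coincidence φ ψ i) :
    ⁅K, K⁆ ≤ K ⊓ coincidence φ ψ (i + 1) := by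
  refine le_inf (Subgroup.commutator_le_self K) (Subgroup.commutator_le.mpr fun a ha b hb => ?_)
  let a' : realCoincidence φ ψ i := ⟨toReal N a, hK ha⟩
  let b' : realCoincidence φ ψ i := ⟨toReal N b, hK hb⟩
  have hab : grDiff φ ψ i ⁅a', b'⁆ = 1 := by
    rw [map_commutatorElement, commutatorElement_eq_one_iff_mul_comm, mul_comm]
  change toReal N ⁅a, b⁆ ∈ realCoincidence φ ψ (i + 1)
  rw [map_commutatorElement]
  exact (grDiff_eq_one_iff (u := ⁅a', b'⁆)).mp hab

end GradedDifference

end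

section CommutativeQuotients

variable {G : Type*} [Group G]

theorem commutatorElement_mem_of_mem_closure {H : Subgroup G} {S : Set G} {b : G}
    (hS : Subgroup.closure S ≤ Subgroup.normalizer H) (h : ∀ a ∈ S, ⁅a, b⁆ ∈ H) {a : G}
    (ha : a ∈ Subgroup.closure S) : ⁅a, b⁆ ∈ H := by
  rw [Subgroup.le_normalizer_iff] at hS
  induction ha using Subgroup.closure_induction with
  | mem a ha => exact h a ha
  | one => exact (commutatorElement_one_left b).symm ▸ one_mem H
  | mul a a' ha _ iha iha' =>
    rw [commutatorElement_mul_left_eq_conj_mul]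
    exact mul_mem (hS a ha _ iha') iha
  | inv a ha iha =>
    have hinv : ⁅a⁻¹, b⁆ = a⁻¹ * ⁅a, b⁆⁻¹ * a⁻¹⁻¹ := by
      rw [commutatorElement_def, commutatorElement_def]
      group
    rw [hinv]
    exact hS _ (inv_mem ha) _ (inv_mem iha)

theorem commutator_closure_le {H : Subgroup G} {S : Set G}
    (hS : Subgroup.closure S ≤ Subgroup.normalizer H) (h : ∀ a ∈ S, ∀ b ∈ S, ⁅a, b⁆ ∈ H) :
    ⁅Subgroup.closure S, Subgroup.closure S⁆ ≤ H := by
  refine Subgroup.commutator_le.mpr fun a ha b hb =>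
    commutatorElement_mem_of_mem_closure hS (fun a ha => ?_) ha
  rw [← inv_mem_iff, commutatorElement_inv]
  exact commutatorElement_mem_of_mem_closure hS (fun b hb => h b hb a ha) hb

theorem exists_commGroup_hom_ker_eq.{u} {U : Type u} [Group U] {H : Subgroup U}
    (h : commutator U ≤ H) : ∃ (E : Type u) (_ : CommGroup E) (π : U →* E), π.ker = H := by
  refine ⟨Abelianization U ⧸ H.map Abelianization.of, inferInstance,
    (QuotientGroup.mk' _).comp Abelianization.of, ?_⟩
  rw [← MonoidHom.comap_ker, QuotientGroup.ker_mk', Subgroup.comap_map_eq, Abelianization.ker_of,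
    sup_eq_left.mpr h]

variable {V E : Type*} [AddCommGroup V] [CommGroup E] {P : G →* Multiplicative V →* E}

theorem exists_finset_mem_closure {x : E}
    (hx : x ∈ Subgroup.closure {y | ∃ g v, y = P g (.ofAdd v)}) :
    ∃ T : Finset V, x ∈ Subgroup.closure {y | ∃ g, ∃ v ∈ T, y = P g (.ofAdd v)} := by
  classical
  have hmono : ∀ T T' : Finset V, T ⊆ T' →
      Subgroup.closure {y | ∃ g, ∃ v ∈ T, y = P g (.ofAdd v)} ≤
        Subgroup.closure {y | ∃ g, ∃ v ∈ T', y = P g (.ofAdd v)} := fun T T' h =>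
    Subgroup.closure_mono fun _ ⟨g, v, hv, hy⟩ => ⟨g, v, h hv, hy⟩
  induction hx using Subgroup.closure_induction with
  | mem x hx =>
    obtain ⟨g, v, rfl⟩ := hx
    exact ⟨{v}, Subgroup.subset_closure ⟨g, v, Finset.mem_singleton_self v, rfl⟩⟩
  | one => exact ⟨∅, one_mem _⟩
  | mul x y _ _ ihx ihy =>
    obtain ⟨T, hT⟩ := ihx
    obtain ⟨T', hT'⟩ := ihy
    exact ⟨T ∪ T', mul_mem (hmono _ _ Finset.subset_union_left hT)
      (hmono _ _ Finset.subset_union_right hT')⟩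
  | inv x _ ihx =>
    obtain ⟨T, hT⟩ := ihx
    exact ⟨T, inv_mem hT⟩

theorem exists_linearIndependent_prod [Module.IsTorsionFree ℤ V] {x : E}
    (hx : x ∈ Subgroup.closure {y | ∃ g v, y = P g (.ofAdd v)}) :
    ∃ (r : ℕ) (s : Fin r → V) (g : Fin r → G), LinearIndependent ℤ s ∧
      x = ∏ l, P (g l) (.ofAdd (s l)) := by
  obtain ⟨T, hT⟩ := exists_finset_mem_closure hx
  let Λ : Submodule ℤ V := Submodule.span ℤ T
  have : Module.Finite ℤ Λ := Module.Finite.span_finset ℤ T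
  let b := Module.finBasis ℤ Λ
  let s : Fin (Module.finrank ℤ Λ) → V := fun l => b l
  have hs : LinearIndependent ℤ s := b.linearIndependent.map' Λ.subtype (Submodule.ker_subtype Λ)
  let Q : (Fin (Module.finrank ℤ Λ) → G) →* E :=
    ∏ l, ((MonoidHom.eval (.ofAdd (s l))).comp P).comp (Pi.evalMonoidHom _ l)
  have hQ : ∀ g, Q g = ∏ l, P (g l) (.ofAdd (s l)) := fun g => MonoidHom.finsetProd_apply _ _ _
  have hrange : Subgroup.closure {y | ∃ g, ∃ v ∈ T, y = P g (.ofAdd v)} ≤ Q.range := by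
    refine (Subgroup.closure_le _).mpr ?_
    rintro _ ⟨g, v, hv, rfl⟩
    let w : Λ := ⟨v, Submodule.subset_span hv⟩
    have hw : v = ∑ l, b.repr w l • s l :=
      (congrArg Λ.subtype (b.sum_repr w)).symm.trans (by simp only [map_sum, map_zsmul]; rfl)
    refine ⟨fun l => g ^ b.repr w l, ?_⟩
    rw [hQ, hw, ofAdd_sum, map_prod]
    refine Finset.prod_congr rfl fun l _ => ?_
    rw [map_zpow, ofAdd_zsmul, map_zpow, MonoidHom.zpow_apply]
  obtain ⟨g, hg⟩ := hrange hT
  exact ⟨_, s, g, hs, by rw [← hg, hQ]⟩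

end CommutativeQuotients

noncomputable section

variable {N : Type*} [Group N] [Group.IsNilpotent N]

/-- `M^ℝ` is polynomially closed if it contains every polynomial curve whose values at the natural
numbers lie in it. -/
def IsPolyClosed (M : Subgroup N) : Prop :=
  ∀ g : ℝ → RealCompletion N, IsPolyCurve g → (∀ n : ℕ, g n ∈ realSpan M) → ∀ t, g t ∈ realSpan M

section Commutators

variable {K L : Subgroup N}

theorem commutator_rpow_mem (hL : IsPolyClosed L) (hKL : ⁅K, K⁆ ≤ L) {a b : N} (ha : a ∈ K)
    (hb : b ∈ K) (s t : ℝ) : ⁅rpow a s, rpow b t⁆ ∈ realSpan L := by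
  have hnat : ∀ (m : ℕ) t, ⁅rpow a m, rpow b t⁆ ∈ realSpan L := fun m => by
    refine hL _ ((IsPolyCurve.const _).commutatorElement (IsPoly.id.rpow b)) fun n => ?_
    rw [rpow_natCast, rpow_natCast, ← map_commutatorElement]
    exact toReal_mem_realSpan
      (hKL (Subgroup.commutator_mem_commutator (pow_mem ha m) (pow_mem hb n)))
  exact hL _ ((IsPoly.id.rpow a).commutatorElement (IsPolyCurve.const _)) (fun m => hnat m t) s

theorem mul_rpow_mem (hL : IsPolyClosed L) (hKL : ⁅K, K⁆ ≤ L) {a b : N} (ha : a ∈ K)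
    (hb : b ∈ K) (t : ℝ) : rpow (a * b) t * (rpow a t * rpow b t)⁻¹ ∈ realSpan L := by
  refine hL _ ((IsPoly.id.rpow _).mul ((IsPoly.id.rpow a).mul (IsPoly.id.rpow b)).inv)
    (fun n => ?_) t
  simp only [rpow_natCast, ← map_inv, ← map_mul]
  refine toReal_mem_realSpan (hKL ?_)
  let a' : K := ⟨a, ha⟩
  let b' : K := ⟨b, hb⟩
  have hab : (a' * b') ^ n * (a' ^ n * b' ^ n)⁻¹ ∈ commutator K := by
    rw [← Abelianization.ker_of, MonoidHom.mem_ker, map_mul, map_inv, map_mul, map_pow, map_pow,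
      map_pow, map_mul, mul_pow, mul_inv_cancel]
  rw [← Subgroup.map_subtype_commutator]
  exact ⟨_, hab, rfl⟩

theorem realSpan_le_normalizer (hL : IsPolyClosed L) (hKL : ⁅K, K⁆ ≤ L) (hLK : L ≤ K) :
    realSpan K ≤ Subgroup.normalizer (realSpan L) := by
  have hconj : ∀ k ∈ K, ∀ t, ∀ x ∈ realSpan L, rpow k t * x * (rpow k t)⁻¹ ∈ realSpan L :=
    fun k hk t x hx => by
    refine realSpan_le (S := (realSpan L).comap (MulAut.conj (rpow k t)).toMonoidHom)
      (fun l hl s => ?_) hx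
    have hkl := mul_mem (commutator_rpow_mem hL hKL hk (hLK hl) t s) (rpow_mem_realSpan hl s)
    rwa [commutatorElement_def, inv_mul_cancel_right] at hkl
  refine realSpan_le fun k hk t => Subgroup.mem_normalizer_iff.mpr fun x => ⟨hconj k hk t x, ?_⟩
  intro hx
  simpa only [rpow_neg, inv_inv, mul_assoc, inv_mul_cancel, mul_one, inv_mul_cancel_left]
    using hconj k hk (-t) _ hx

theorem commutator_realSpan_le (hL : IsPolyClosed L) (hKL : ⁅K, K⁆ ≤ L) (hLK : L ≤ K) :
    ⁅realSpan K, realSpan K⁆ ≤ realSpan L := by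
  refine commutator_closure_le (realSpan_le_normalizer hL hKL hLK) ?_
  rintro _ ⟨a, ha, s, rfl⟩ _ ⟨b, hb, t, rfl⟩
  exact commutator_rpow_mem hL hKL ha hb s t

/-- The one-parameter subgroup `t ↦ k ^ t` of `K^ℝ`. -/
def spanRpow {K : Subgroup N} (k : K) : Multiplicative ℝ →* realSpan K where
  toFun t := ⟨rpow k t.toAdd, rpow_mem_realSpan k.2 _⟩
  map_one' := Subtype.ext (rpow_zero _)
  map_mul' s t := Subtype.ext (rpow_add _ s.toAdd t.toAdd)

theorem exists_linearIndependent_rpow_prod (hL : IsPolyClosed L) (hKL : ⁅K, K⁆ ≤ L) (hLK : L ≤ K)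
    {x : RealCompletion N} (hx : x ∈ realSpan K) :
    ∃ (r : ℕ) (s : Fin r → ℝ) (k : Fin r → N), LinearIndependent ℤ s ∧ (∀ l, k l ∈ K) ∧
      x⁻¹ * (List.ofFn fun l => rpow (k l) (s l)).prod ∈ realSpan L := by
  obtain ⟨E, _, π, hπ⟩ := exists_commGroup_hom_ker_eq
    (H := (realSpan L).subgroupOf (realSpan K)) (Subgroup.map_le_iff_le_comap.mp
      ((Subgroup.map_subtype_commutator _).trans_le (commutator_realSpan_le hL hKL hLK)))
  let P : K →* Multiplicative ℝ →* E := MonoidHom.mk' (fun k => π.comp (spanRpow k)) fun a b => by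
    refine MonoidHom.ext fun t => mul_inv_eq_one.mp ?_
    rw [MonoidHom.mul_apply, MonoidHom.comp_apply, MonoidHom.comp_apply, MonoidHom.comp_apply,
      ← map_mul, ← map_inv, ← map_mul, ← MonoidHom.mem_ker, hπ]
    exact mul_rpow_mem hL hKL a.2 b.2 t.toAdd
  have hspan : realSpan K ≤ ((Subgroup.closure {y | ∃ k t, y = P k (.ofAdd t)}).comap π).map
      (realSpan K).subtype := realSpan_le fun k hk t =>
    ⟨spanRpow ⟨k, hk⟩ (.ofAdd t), Subgroup.subset_closure ⟨⟨k, hk⟩, t, rfl⟩, rfl⟩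
  obtain ⟨x, hxP, rfl⟩ := hspan hx
  obtain ⟨r, s, k, hs, hprod⟩ := exists_linearIndependent_prod hxP
  refine ⟨r, s, fun l => k l, hs, fun l => (k l).2, ?_⟩
  let y : realSpan K := (List.ofFn fun l => spanRpow (k l) (.ofAdd (s l))).prod
  have hy : x⁻¹ * y ∈ π.ker := by
    rw [MonoidHom.mem_ker, map_mul, map_inv, hprod, map_list_prod, List.map_ofFn, List.prod_ofFn]
    exact inv_mul_cancel _
  rw [hπ, Subgroup.mem_subgroupOf, Subgroup.coe_mul, Subgroup.val_list_prod, List.map_ofFn] at hy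
  exact hy

end Commutators

section Intersection

variable {φ ψ : N →* N} {i : ℕ} {K : Subgroup N}

theorem truncCoeff_smul_truncDiff (ρ : ℝ →+ ℝ) (r : ℝ) (n : N) :
    truncCoeff ρ (r • truncDiff φ ψ (toTrunc N n)) = ρ r • truncDiff φ ψ (toTrunc N n) := by
  rw [truncDiff_toTrunc, smul_sub, map_sub, truncCoeff_smul_toTrunc, truncCoeff_smul_toTrunc,
    smul_sub]

theorem truncDiff_mem_of_sum_smul_mem {r : ℕ} {s : Fin r → ℝ} {k : Fin r → N}
    (hs : LinearIndependent ℤ s)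
    (h : ∑ l, s l • truncDiff φ ψ (toTrunc N (k l)) ∈ truncFiltration N i) (l : Fin r) :
    truncDiff φ ψ (toTrunc N (k l)) ∈ truncFiltration N i := by
  obtain ⟨f, hf, hf₀⟩ :=
    exists_coordinate_functional ((LinearIndependent.iff_fractionRing ℤ ℚ).mp hs) l
  let ρ : ℝ →+ ℝ := (Rat.castHom ℝ).toAddMonoidHom.comp f.toAddMonoidHom
  have hρ : ∀ j, ρ (s j) = ((f (s j) : ℚ) : ℝ) := fun _ => rfl
  have hcoord : truncCoeff ρ (∑ l, s l • truncDiff φ ψ (toTrunc N (k l))) =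
      truncDiff φ ψ (toTrunc N (k l)) := by
    rw [map_sum, Finset.sum_eq_single_of_mem l (Finset.mem_univ l) fun j _ hj => ?_,
      truncCoeff_smul_truncDiff, hρ, hf, Rat.cast_one, one_smul]
    rw [truncCoeff_smul_truncDiff, hρ, hf₀ j hj, Rat.cast_zero, zero_smul]
  exact hcoord ▸ truncCoeff_mem_truncFiltration ρ h

theorem mem_realSpan_inf_coincidence (hK : K ≤ coincidence φ ψ i)
    (hL : IsPolyClosed (K ⊓ coincidence φ ψ (i + 1))) {x : RealCompletion N} (hx : x ∈ realSpan K)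
    (hxc : x ∈ realCoincidence φ ψ (i + 1)) : x ∈ realSpan (K ⊓ coincidence φ ψ (i + 1)) := by
  obtain ⟨r, s, k, hs, hk, hprod⟩ :=
    exists_linearIndependent_rpow_prod hL (commutator_le_inf_coincidence hK) inf_le_left hx
  have hkc : ∀ l, rpow (k l) (s l) ∈ realCoincidence φ ψ i := fun l =>
    realSpan_coincidence_le (rpow_mem_realSpan (hK (hk l)) _)
  have hmem : (List.ofFn fun l => rpow (k l) (s l)).prod ∈ realCoincidence φ ψ (i + 1) :=
    (mul_mem_cancel_left (inv_mem hxc)).mp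
      (realSpan_coincidence_le (realSpan_mono inf_le_right hprod))
  have hsum : ∑ l, s l • truncDiff φ ψ (toTrunc N (k l)) ∈ truncFiltration N (i + 1) :=
    SModEq.zero.mp (((SModEq.sum fun l _ => (truncDiff_rpow_smodEq (hK (hk l)) (s l)).symm).trans
      (truncDiff_prod_ofFn_smodEq hkc).symm).trans (SModEq.zero.mpr hmem))
  have hkL : ∀ l, k l ∈ K ⊓ coincidence φ ψ (i + 1) := fun l =>
    ⟨hk l, mem_coincidence.mpr (truncDiff_mem_of_sum_smul_mem hs hsum l)⟩
  exact inv_mem_iff.mp ((mul_mem_cancel_right (list_prod_mem (List.forall_mem_ofFn_iff.mpr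
    fun l => rpow_mem_realSpan (hkL l) (s l)))).mp hprod)

end Intersection

section PolynomialLifts

variable {φ ψ : N →* N} {i : ℕ} {M : Subgroup N}

theorem truncDiff_inv_smodEq {u : RealCompletion N} (hu : u ∈ realCoincidence φ ψ i) :
    truncDiff φ ψ (toAlg u⁻¹) ≡ -truncDiff φ ψ (toAlg u) [SMOD truncFiltration N (i + 1)] :=
  congrArg Multiplicative.toAdd (map_inv (grDiff φ ψ i) ⟨u, hu⟩)

variable (φ ψ i M) in
/-- The real span, in the `i`-th graded piece of the truncated group algebra, of the differences of
`φ` and `ψ` on `M`. -/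
def gradedSpan : Submodule ℝ (TruncAlgebra N ⧸ truncFiltration N (i + 1)) :=
  Submodule.span ℝ ((fun m => Submodule.Quotient.mk (truncDiff φ ψ (toTrunc N m))) '' M)

theorem mk_truncDiff_mem_gradedSpan (hM : M ≤ coincidence φ ψ i) {x : RealCompletion N}
    (hx : x ∈ realSpan M) :
    Submodule.Quotient.mk (truncDiff φ ψ (toAlg x)) ∈ gradedSpan φ ψ i M := by
  have hle : realSpan M ≤ realCoincidence φ ψ i :=
    (realSpan_mono hM).trans realSpan_coincidence_le
  induction hx using Subgroup.closure_induction with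
  | mem x hx =>
    obtain ⟨m, hm, t, rfl⟩ := hx
    have hrpow := Submodule.smul_mem (gradedSpan φ ψ i M) t (Submodule.subset_span ⟨m, hm, rfl⟩)
    exact (truncDiff_rpow_smodEq (hM hm) t).symm ▸ hrpow
  | one => exact (truncDiff_toAlg_one φ ψ).symm ▸ zero_mem _
  | mul x y hx hy ihx ihy =>
    exact (truncDiff_mul_smodEq (hle hx) (hle hy)).symm ▸ add_mem ihx ihy
  | inv x hx ih => exact (truncDiff_inv_smodEq (hle hx)).symm ▸ neg_mem ih

variable (φ ψ M) in
/-- The curve `f` in the `i`-th graded piece of the truncated group algebra is the difference of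
`φ^ℝ` and `ψ^ℝ` along a polynomial curve in `M^ℝ`. -/
def HasPolyLift (f : ℝ → TruncAlgebra N ⧸ truncFiltration N (i + 1)) : Prop :=
  ∃ u : ℝ → RealCompletion N, IsPolyCurve u ∧ (∀ t, u t ∈ realSpan M) ∧
    ∀ t, Submodule.Quotient.mk (truncDiff φ ψ (toAlg (u t))) = f t

namespace HasPolyLift

theorem zero : HasPolyLift φ ψ M (i := i) fun _ => 0 :=
  ⟨fun _ => 1, IsPolyCurve.const 1, fun _ => one_mem _,
    fun _ => congrArg Submodule.Quotient.mk (truncDiff_toAlg_one φ ψ)⟩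

variable (hM : M ≤ coincidence φ ψ i)
include hM

theorem add {f g : ℝ → TruncAlgebra N ⧸ truncFiltration N (i + 1)} (hf : HasPolyLift φ ψ M f)
    (hg : HasPolyLift φ ψ M g) : HasPolyLift φ ψ M fun t => f t + g t := by
  obtain ⟨u, hu, huM, huf⟩ := hf
  obtain ⟨v, hv, hvM, hvg⟩ := hg
  have hle := (realSpan_mono hM).trans realSpan_coincidence_le
  refine ⟨fun t => u t * v t, hu.mul hv, fun t => mul_mem (huM t) (hvM t), fun t =>
    Eq.trans (truncDiff_mul_smodEq (hle (huM t)) (hle (hvM t))) (congrArg₂ (· + ·) (huf t) (hvg t))⟩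

theorem sum {ι : Type*} (s : Finset ι) {f : ι → ℝ → TruncAlgebra N ⧸ truncFiltration N (i + 1)}
    (hf : ∀ k ∈ s, HasPolyLift φ ψ M (f k)) : HasPolyLift φ ψ M fun t => ∑ k ∈ s, f k t := by
  classical
  induction s using Finset.induction_on with
  | empty => exact zero
  | insert k s hk ih =>
    simp only [Finset.sum_insert hk]
    exact (hf k (Finset.mem_insert_self k s)).add hM
      (ih fun j hj => hf j (Finset.mem_insert_of_mem hj))

theorem smul {q : ℝ → ℝ} (hq : IsPoly q) {a : TruncAlgebra N ⧸ truncFiltration N (i + 1)}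
    (ha : a ∈ gradedSpan φ ψ i M) : HasPolyLift φ ψ M fun t => q t • a := by
  induction ha using Submodule.closure_induction with
  | zero => simpa only [smul_zero] using zero
  | add a b _ _ iha ihb => simpa only [smul_add] using iha.add hM ihb
  | smul_mem r a ha =>
    obtain ⟨m, hm, rfl⟩ := ha
    refine ⟨fun t => rpow m (q t * r), (hq.mul (IsPoly.const r)).rpow m,
      fun t => rpow_mem_realSpan hm _, fun t =>
      Eq.trans (truncDiff_rpow_smodEq (hM hm) _) (congrArg Submodule.Quotient.mk (mul_smul _ _ _))⟩

end HasPolyLift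

end PolynomialLifts

section PolyClosed

variable {φ ψ : N →* N} {i : ℕ} {M : Subgroup N}

theorem IsPolyCurve.hasPolyLift (hM : M ≤ coincidence φ ψ i) {g : ℝ → RealCompletion N}
    (hg : IsPolyCurve g) (hgM : ∀ n : ℕ, g n ∈ realSpan M) :
    HasPolyLift φ ψ M (i := i) fun t => Submodule.Quotient.mk (truncDiff φ ψ (toAlg (g t))) := by
  obtain ⟨a, ha⟩ := IsPoly.map hg ((truncFiltration N (i + 1)).mkQ ∘ₗ truncDiff φ ψ)
  have hcoeff := coeff_mem_of_forall_nat (S := gradedSpan φ ψ i M) (a := a)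
    fun n => ha n ▸ mk_truncDiff_mem_gradedSpan hM (hgM n)
  have hlift := HasPolyLift.sum hM a.support fun k _ =>
    HasPolyLift.smul hM (IsPoly.id.pow k) (hcoeff k)
  exact (funext ha).symm ▸ hlift

theorem IsPolyClosed.of_inf (hM : M ≤ coincidence φ ψ i)
    (hL : IsPolyClosed (M ⊓ coincidence φ ψ (i + 1))) : IsPolyClosed M := by
  intro g hg hgM t
  obtain ⟨u, hu, huM, hug⟩ := hg.hasPolyLift hM hgM
  have hle := (realSpan_mono hM).trans realSpan_coincidence_le
  have hquot : ∀ n : ℕ, (u n)⁻¹ * g n ∈ realSpan (M ⊓ coincidence φ ψ (i + 1)) := fun n =>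
    mem_realSpan_inf_coincidence hM hL (mul_mem (inv_mem (huM n)) (hgM n))
      (inv_mul_mem_realCoincidence_succ (hle (huM n)) (hle (hgM n)) (hug n))
  exact (mul_mem_cancel_left (inv_mem (huM t))).mp
    (realSpan_mono inf_le_left (hL _ (hu.inv.mul hg) hquot t))

theorem eq_one_of_mem_realCoincidence {u : RealCompletion N}
    (hu : u ∈ realCoincidence (MonoidHom.id N) 1 (Group.nilpotencyClass N + 1)) : u = 1 := by
  change truncDiff _ _ (toAlg u) ∈ truncFiltration N _ at hu
  rw [truncDiff_id_one_toAlg, truncFiltration_nilpotencyClass_succ, Submodule.mem_bot,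
    sub_eq_zero] at hu
  exact toAlg_injective (hu.trans (map_one toAlg).symm)

theorem isPolyClosed_of_le_coincidence (hi : i ≤ Group.nilpotencyClass N + 1)
    (hM : M ≤ coincidence (MonoidHom.id N) 1 i) : IsPolyClosed M := by
  induction hi using Nat.decreasingInduction generalizing M with
  | self =>
    intro g hg hgM t
    have hone : ∀ n : ℕ, g n = 1 := fun n => eq_one_of_mem_realCoincidence
      (realSpan_coincidence_le (realSpan_mono hM (hgM n)))
    have ht : g t = 1 := toAlg_injective
      (hg.eq_of_forall_nat (IsPolyCurve.const 1) (fun n => congrArg toAlg (hone n)) t)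
    exact ht ▸ one_mem _
  | of_succ i _ ih => exact IsPolyClosed.of_inf hM (ih inf_le_right)

theorem isPolyClosed (M : Subgroup N) : IsPolyClosed M :=
  isPolyClosed_of_le_coincidence (Nat.zero_le _) (coincidence_zero.ge.trans' le_top)

end PolyClosed

section Descent

variable {φ ψ : N →* N} {i : ℕ}

theorem exists_truncDiff_smodEq_rat_smul (hrad : IsRadicable N) {k : N}
    (hk : k ∈ coincidence φ ψ i) (q : ℚ) : ∃ m ∈ coincidence φ ψ i,
      truncDiff φ ψ (toTrunc N m) ≡ (q : ℝ) • truncDiff φ ψ (toTrunc N k)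
        [SMOD truncFiltration N (i + 1)] := by
  obtain ⟨m, rfl⟩ := hrad k q.den q.den_pos
  have hm : m ∈ coincidence φ ψ i := isIsolated_coincidence q.den_pos hk
  have hden := truncDiff_rpow_smodEq hm q.den
  have hnum := truncDiff_rpow_smodEq hm q.num
  rw [rpow_natCast, toAlg_toReal] at hden
  rw [rpow_intCast, toAlg_toReal] at hnum
  refine ⟨m ^ q.num, zpow_mem hm _, hnum.trans ?_⟩
  have hq : (q.num : ℝ) = q * q.den := mod_cast q.mul_den_eq_num.symm
  rw [hq, mul_smul]
  exact (hden.smul (q : ℝ)).symm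

theorem truncCoeff_smodEq (ρ : ℝ →+ ℝ) {a b : TruncAlgebra N}
    (h : a ≡ b [SMOD truncFiltration N i]) :
    truncCoeff ρ a ≡ truncCoeff ρ b [SMOD truncFiltration N i] := by
  rw [SModEq.sub_mem, ← map_sub]
  exact truncCoeff_mem_truncFiltration ρ (SModEq.sub_mem.mp h)

theorem exists_truncDiff_smodEq_truncCoeff (hrad : IsRadicable N) (ρ : ℝ →+ ℚ)
    {x : RealCompletion N} (hx : x ∈ realSpan (coincidence φ ψ i)) :
    ∃ k ∈ coincidence φ ψ i, truncDiff φ ψ (toTrunc N k) ≡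
      truncCoeff ((Rat.castHom ℝ).toAddMonoidHom.comp ρ) (truncDiff φ ψ (toAlg x))
        [SMOD truncFiltration N (i + 1)] := by
  simp only [← toAlg_toReal]
  induction hx using Subgroup.closure_induction with
  | mem x hx =>
    obtain ⟨k, hk, t, rfl⟩ := hx
    obtain ⟨m, hm, hmk⟩ := exists_truncDiff_smodEq_rat_smul hrad hk (ρ t)
    have hcoeff := truncCoeff_smodEq ((Rat.castHom ℝ).toAddMonoidHom.comp ρ)
      (truncDiff_rpow_smodEq hk t)
    rw [truncCoeff_smul_truncDiff] at hcoeff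
    exact ⟨m, hm, (toAlg_toReal m ▸ hmk).trans hcoeff.symm⟩
  | one => exact ⟨1, one_mem _, by rw [map_one (toReal N), truncDiff_toAlg_one, map_zero]⟩
  | mul x y hx hy ihx ihy =>
    obtain ⟨k, hk, hkx⟩ := ihx
    obtain ⟨l, hl, hly⟩ := ihy
    have hxy := truncCoeff_smodEq ((Rat.castHom ℝ).toAddMonoidHom.comp ρ)
      (truncDiff_mul_smodEq (realSpan_coincidence_le hx) (realSpan_coincidence_le hy))
    rw [map_add] at hxy
    refine ⟨k * l, mul_mem hk hl, ?_⟩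
    rw [map_mul (toReal N)]
    exact (truncDiff_mul_smodEq hk hl).trans ((hkx.add hly).trans hxy.symm)
  | inv x hx ih =>
    obtain ⟨k, hk, hkx⟩ := ih
    have hxinv := truncCoeff_smodEq ((Rat.castHom ℝ).toAddMonoidHom.comp ρ)
      (truncDiff_inv_smodEq (realSpan_coincidence_le hx))
    rw [map_neg] at hxinv
    refine ⟨k⁻¹, inv_mem hk, ?_⟩
    rw [map_inv (toReal N)]
    exact (truncDiff_inv_smodEq hk).trans (hkx.neg.trans hxinv.symm)

theorem truncDiff_smodEq_toTrunc_sub_one {x : RealCompletion N} {n : N}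
    (hx : x ∈ realCoincidence φ ψ i)
    (hn : toReal N n = realExtension φ x * (realExtension ψ x)⁻¹) :
    truncDiff φ ψ (toAlg x) ≡ toTrunc N n - 1 [SMOD truncFiltration N (i + 1)] := by
  have hn' : toTrunc N n - 1 = truncDiff φ ψ (toAlg x) * toAlg (realExtension ψ x)⁻¹ := by
    rw [truncDiff_toAlg, sub_mul, ← map_mul, ← map_mul, mul_inv_cancel, map_one, ← hn, toAlg_toReal]
  refine SModEq.symm (SModEq.sub_mem.mpr ?_)
  rw [hn', ← mul_sub_one]
  exact mul_mem_truncFiltration hx (toAlg_sub_one_mem _)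

theorem exists_inv_mul_mem_realSpan_succ (hrad : IsRadicable N) {x : RealCompletion N}
    (hx : x ∈ realSpan (coincidence φ ψ i))
    (hrat : realExtension φ x * (realExtension ψ x)⁻¹ ∈ rationalPoints N) :
    ∃ k : N, (toReal N k)⁻¹ * x ∈ realSpan (coincidence φ ψ (i + 1)) := by
  obtain ⟨n, hn⟩ := hrat
  obtain ⟨f, hf, -⟩ := exists_coordinate_functional
    (LinearIndependent.of_subsingleton (R := ℚ) (v := fun _ : Unit => (1 : ℝ)) () one_ne_zero) ()
  let ρ : ℝ →+ ℝ := (Rat.castHom ℝ).toAddMonoidHom.comp f.toAddMonoidHom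
  have hρ : ρ 1 = 1 := (congrArg _ hf).trans Rat.cast_one
  obtain ⟨k, hk, hkx⟩ := exists_truncDiff_smodEq_truncCoeff hrad f.toAddMonoidHom hx
  have hxn := truncDiff_smodEq_toTrunc_sub_one (realSpan_coincidence_le hx) hn
  have hfix : truncCoeff ρ (toTrunc N n - 1) = toTrunc N n - 1 := by
    have hρn : ∀ m, truncCoeff ρ (toTrunc N m) = toTrunc N m := fun m => by
      simpa only [one_smul, hρ] using truncCoeff_smul_toTrunc ρ 1 m
    rw [map_sub, hρn, ← map_one (toTrunc N), hρn]
  have hkx' : truncDiff φ ψ (toAlg (toReal N k)) ≡ truncDiff φ ψ (toAlg x)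
      [SMOD truncFiltration N (i + 1)] := by
    rw [toAlg_toReal]
    exact (hkx.trans (hfix ▸ truncCoeff_smodEq ρ hxn)).trans hxn.symm
  exact ⟨k, realSpan_mono inf_le_right (mem_realSpan_inf_coincidence le_rfl (isPolyClosed _)
    (mul_mem (inv_mem (toReal_mem_realSpan hk)) hx)
    (inv_mul_mem_realCoincidence_succ hk (realSpan_coincidence_le hx) hkx'))⟩

theorem exists_inv_mul_mem_realSpan (hrad : IsRadicable N) {x : RealCompletion N}
    (hrat : realExtension φ x * (realExtension ψ x)⁻¹ ∈ rationalPoints N) (i : ℕ) :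
    ∃ m : N, (toReal N m)⁻¹ * x ∈ realSpan (coincidence φ ψ i) := by
  induction i with
  | zero => exact ⟨1, by rw [coincidence_zero, realSpan_top]; exact Subgroup.mem_top _⟩
  | succ i ih =>
    obtain ⟨m, hm⟩ := ih
    have hratm : (toReal N (φ m))⁻¹ * (realExtension φ x * (realExtension ψ x)⁻¹) *
        toReal N (ψ m) ∈ rationalPoints N :=
      mul_mem (mul_mem (inv_mem ⟨φ m, rfl⟩) hrat) ⟨ψ m, rfl⟩
    obtain ⟨k, hk⟩ := exists_inv_mul_mem_realSpan_succ hrad hm (by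
      convert hratm using 1
      rw [map_mul, map_mul, map_inv, map_inv, realExtension_toReal, realExtension_toReal]
      group)
    exact ⟨m * k, by rwa [map_mul, mul_inv_rev, mul_assoc]⟩

end Descent

end

end RealMalcev

theorem mainTheorem3 {N : Type*} [Group N] [Group.IsNilpotent N]
    (htf : ∀ n : N, n ≠ 1 → ¬ IsOfFinOrder n)
    (hrad : ∀ (n : N) (k : ℕ), 0 < k → ∃ m : N, m ^ k = n)
    (φ ψ : N →* N) :
    (∀ h ∈ φ.eqLocus ψ, ∀ k : ℕ, 0 < k → ∃ m ∈ φ.eqLocus ψ, m ^ k = h) ∧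
    ∀ n : RealMalcev.RealCompletion N,
      RealMalcev.realExtension φ n * (RealMalcev.realExtension ψ n)⁻¹ ∈
          RealMalcev.rationalPoints N ↔
        n ∈ (RealMalcev.rationalPoints N : Set (RealMalcev.RealCompletion N)) *
          (RealMalcev.realSpan (φ.eqLocus ψ) : Set (RealMalcev.RealCompletion N)) := by
  have hco := RealMalcev.coincidence_nilpotencyClass_succ
    (RealMalcev.toTrunc_injective (RealMalcev.isIsolated_bot htf) hrad) φ ψ
  refine ⟨fun h hh k hk => ?_, fun x => ⟨fun hrat => ?_, ?_⟩⟩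
  · obtain ⟨m, rfl⟩ := hrad h k hk
    rw [← hco] at hh ⊢
    exact ⟨m, RealMalcev.isIsolated_coincidence hk hh, rfl⟩
  · obtain ⟨m, hm⟩ := RealMalcev.exists_inv_mul_mem_realSpan hrad hrat _
    exact Set.mem_mul.mpr ⟨_, ⟨m, rfl⟩, _, hco ▸ hm, mul_inv_cancel_left _ _⟩
  · rintro ⟨_, ⟨m, rfl⟩, h, hh, rfl⟩
    have heq : RealMalcev.realExtension φ h = RealMalcev.realExtension ψ h :=
      RealMalcev.eq_of_mem_realSpan (fun k (hk : φ k = ψ k) t => by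
        rw [RealMalcev.realExtension_rpow, RealMalcev.realExtension_rpow, hk]) hh
    refine ⟨φ m * (ψ m)⁻¹, ?_⟩
    simp only [map_mul, map_inv, RealMalcev.realExtension_toReal, heq]
    group
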